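/- Let $d,L,m\ge 1$. For an activation $\sigma:\mathbb R\to\mathbb R$ and a constant $c>0$ consider the fully connected network with $L$ hidden layers of width $m$, input $x\in\mathbb R^d$ and scalar output, $$\alpha^{(0)}(x)=x,\qquad \alpha^{(l)}(x)=\tfrac{c}{\sqrt m}\,\sigma\big(W^{(l)}\alpha^{(l-1)}(x)\big)\ (1\le l\le L),\qquad f(x)=W^{(L+1)}\alpha^{(L)}(x),$$ where $\sigma$ acts entrywise, $W^{(1)}\in\mathbb R^{m\times d}$, $W^{(l)}\in\mathbb R^{m\times m}$ for $2\le l\le L$, $W^{(L+1)}\in\mathbb R^{1\times m}$. The ReLU network has $\sigma(t)=\max\{0,t\}$ and $c=\sqrt2$; the linear network has $\sigma(t)=t$ and $c=1$. At initialization all entries of all $W^{(l)}$ are i.i.d. $\mathcal N(0,1)$. The model gradient $\nabla f(x)$ is the gradient of $f(x)$ with respect to all parameters. For nonzero $x,z\in\mathbb R^d$ let $\theta_{in}=\theta_{in}(x,z)\in[0,\pi]$ be the angle between $x$ and $z$. The model gradient angle of the infinitely wide network at initialization is the deterministic limit in probability, as $m\to\infty$, of the angle between $\nabla f(x)$ and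 $\nabla f(z)$. For all $d,L\ge1$ and all nonzero $x,z\in\mathbb R^d$, the model gradient angle $\phi_L=\phi_L(x,z)\in[0,\pi]$ of the infinitely wide ReLU network with $L$ hidden layers exists, and there are functions $r_L:\mathbb R\to\mathbb R$ ($L\ge 1$), not depending on $d,x,z$, such that the following hold. 1. Whenever $\theta_{in}<\pi/2$, $$\cos\phi_L=\Big(1-\frac{L}{2\pi}\theta_{in}+r_L(\theta_{in})\Big)\cos\theta_{in}.$$ For each fixed $L$, $r_L(\theta)=o(\theta)$ as $\theta\to0^+$. Moreover, in the joint regime $\theta=o(1/L)$, $r_L(\theta)=o(L\theta)$ uniformly in $L$: for every $\varepsilon>0$ there is $\delta>0$ such that $|r_L(\theta)|\le\varepsilon L\theta$ for all $L\ge1$ and $\theta\ge0$ with $L\theta<\delta$. 2. For all $d,L\ge 1$ and all nonzero $x,z\in\mathbb R^d$, the model gradient angle of the infinitely wide linear network with $L$ hidden layers exists and equals $\theta_{in}$. 3. There is an absolute constant $c_0>0$ such that for all $d,L\ge 1$ and nonzero $x,z\in\mathbb R^d$ with $\theta_{in}>0$: if $L\theta_{in}<c_0$, then $\phi_L>\theta_{in}$;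 and if $1\le L_1<L_2$ and $L_2\theta_{in}<c_0$, then $\phi_{L_1}<\phi_{L_2}$. -/

import Mathlib

open Real Set Filter Topology MeasureTheory ProbabilityTheory Asymptotics InnerProductGeometry

noncomputable section

namespace WideNet

/-- Width of layer `l`: the input layer has `d` units, every hidden layer has `m` units. -/
def layerWidth (d m : ℕ) : ℕ → ℕ
  | 0 => d
  | _ + 1 => m

/-- Index set of all scalar parameters of a fully connected network with input dimension `d`,
`L` hidden layers of width `m` and one output unit. The entry `Sum.inl ⟨l, i, j⟩` is the weight
from unit `j` of layer `l` to unit `i` of layer `l + 1` (for `l = 0, …, L - 1`); the entry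
`Sum.inr j` is the weight from unit `j` of layer `L` to the output. -/
abbrev ParamIdx (d m L : ℕ) : Type :=
  (Σ l : Fin L, Fin (layerWidth d m (l + 1)) × Fin (layerWidth d m l)) ⊕ Fin (layerWidth d m L)

/-- The space of all parameters, flattened to one Euclidean vector. -/
abbrev Params (d m L : ℕ) : Type := EuclideanSpace ℝ (ParamIdx d m L)

/-- The embedding of the input `x` at layer `l`, for activation `σ` and scaling constant `c`:
`α⁽⁰⁾ = x` and `α⁽ˡ⁺¹⁾ = (c / √m) σ(W⁽ˡ⁺¹⁾ α⁽ˡ⁾)` for `l < L`.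
(Layers beyond `L` do not exist; they get the value `0`, which is never used.) -/
def embedding {d m L : ℕ} (σ : ℝ → ℝ) (c : ℝ) (w : Params d m L)
    (x : EuclideanSpace ℝ (Fin d)) : (l : ℕ) → EuclideanSpace ℝ (Fin (layerWidth d m l))
  | 0 => x
  | l + 1 => WithLp.toLp 2 fun i =>
      if h : l < L then
        c / √(m : ℝ) * σ (∑ j, w (Sum.inl ⟨⟨l, h⟩, i, j⟩) * embedding σ c w x l j)
      else 0

/-- The network output `f(w; x) = W⁽ᴸ⁺¹⁾ α⁽ᴸ⁾(x)`. -/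
def network {d m L : ℕ} (σ : ℝ → ℝ) (c : ℝ) (w : Params d m L)
    (x : EuclideanSpace ℝ (Fin d)) : ℝ :=
  ∑ j, w (Sum.inr j) * embedding σ c w x L j

/-- The model gradient: the gradient of `f(w; x)` with respect to all parameters `w`. -/
def modelGradient {d m L : ℕ} (σ : ℝ → ℝ) (c : ℝ) (w : Params d m L)
    (x : EuclideanSpace ℝ (Fin d)) : Params d m L :=
  gradient (fun v : Params d m L => network σ c v x) w

/-- The model gradient angle at width `m` and parameters `w`. -/
def modelGradientAngle {d m L : ℕ} (σ : ℝ → ℝ) (c : ℝ) (w : Params d m L)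
    (x z : EuclideanSpace ℝ (Fin d)) : ℝ :=
  angle (modelGradient σ c w x) (modelGradient σ c w z)

/-- The random initialization: all parameters are i.i.d. standard normal. -/
def initLaw (d m L : ℕ) : Measure (Params d m L) :=
  (Measure.pi fun _ : ParamIdx d m L => gaussianReal 0 1).map (WithLp.toLp 2)

/-- `φ` is the model gradient angle of the infinitely wide network at initialization: the random
model gradient angle at width `m` converges to the number `φ` in probability as `m → ∞`. -/
def IsInfiniteWidthAngle {d : ℕ} (σ : ℝ → ℝ) (c : ℝ) (L : ℕ)
    (x z : EuclideanSpace ℝ (Fin d)) (φ : ℝ) : Prop :=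
  ∀ ε : ℝ, 0 < ε →
    Tendsto (fun m : ℕ => initLaw d m L {w | ε ≤ |modelGradientAngle σ c w x z - φ|})
      atTop (𝓝 0)

/-- The ReLU network: activation `t ↦ max 0 t`, scaling `√2 / √m`. -/
def IsReLUAngle {d : ℕ} (L : ℕ) (x z : EuclideanSpace ℝ (Fin d)) (φ : ℝ) : Prop :=
  IsInfiniteWidthAngle (fun t => max 0 t) (√2) L x z φ

/-- The linear network: identity activation, scaling `1 / √m`. -/
def IsLinearAngle {d : ℕ} (L : ℕ) (x z : EuclideanSpace ℝ (Fin d)) (φ : ℝ) : Prop :=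
  IsInfiniteWidthAngle (fun t => t) 1 L x z φ

end WideNet

end

noncomputable section

namespace WideNet

/-! Structure of the gradient. The gradient of a unit of layer `l + 1` is a Gaussian combination of
the gradients of the units of layer `l`, plus the directions of the weights just introduced, and the
two parts are orthogonal. Let `A` be the Gram matrix of the gradients of layer `l` at `x` against
those at `z`. By `gradGram_succ`, entry `(i, k)` of the next Gram matrix is `c² / m` times a product
of two activation derivatives times the bilinear form of `A` in the weight rows `i` and `k`, with
the inner product of the embeddings added to the form when `i = k`.

Infinite width. Condition on the layers below. The rows are independent, so averages over a layer
concentrate (`tendsto_randAverage`): the Gram entries of the embeddings follow the iterates of the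
kernel `k₁`, and the averaged derivative products follow `k₀`. A Gaussian quadratic form with matrix
`A` has mean `tr A` and variance at most twice the squared Frobenius norm of `A`. Hence two numbers
suffice for the induction: the trace converges (`tendsto_randTrace_succ`) and the Frobenius norm
tends to zero (`tendsto_randFrob_succ`), starting from `A = 0`. The derivatives depend on the same
rows as the forms; this does no harm, because their product is bounded by one. The output adds one
last quadratic form, so the inner product of the model gradients tends to `‖x‖ ‖z‖ (L + 1)
limitCos`. For `x = z` the limit is `‖x‖² (L + 1)`, which normalizes, and `arccos` is continuous.

Small angles. Put `S L = kernelSum L θ`. Then `S (L + 1) = ρ + S L * (1 - t / π)`, where `t` is the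
angle of the embeddings at layer `L` and `cos θ ≤ ρ ≤ 1`. One ReLU layer shrinks the embedding angle
only quadratically, because `sin θ - θ cos θ` is of third order, so `t` is `θ` up to `L θ²`. The
first-order loss therefore comes from the derivative kernel `1 - t / π` alone: the losses `j θ / π`
for `j = 1, …, L` add up to `(L + 1) L θ / (2π)`. Keeping all errors quadratic in `L θ`, uniformly
in `L`, gives the expansion, both little-o claims and the comparison of depths. In the linear
network the derivative kernel is `1` and every summand equals `cos θ`, so nothing is lost. -/

/-! ### Gaussian pairs: reduction to the plane and polar coordinates. -/

lemma charFunDual_stdGaussian_map_inner_pair {E : Type*}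
    [NormedAddCommGroup E] [InnerProductSpace ℝ E] [FiniteDimensional ℝ E]
    [MeasurableSpace E] [BorelSpace E] (u v : E) (M : StrongDual ℝ (ℝ × ℝ)) :
    charFunDual ((stdGaussian E).map (fun w => (inner ℝ u w, inner ℝ v w))) M =
      Complex.exp (-((‖M (1, 0) • u + M (0, 1) • v‖ : ℝ) : ℂ) ^ 2 / 2) := by
  have h1 : (fun w => ((inner ℝ u w, inner ℝ v w) : ℝ × ℝ)) =
      ((innerSL ℝ u).prod (innerSL ℝ v) : E →L[ℝ] ℝ × ℝ) := by
    ext w <;> simp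
  have h2 : M.comp ((innerSL ℝ u).prod (innerSL ℝ v)) =
      innerSL ℝ (M (1, 0) • u + M (0, 1) • v) := by
    ext w
    have h3 : ((inner ℝ u w, inner ℝ v w) : ℝ × ℝ) =
        (inner ℝ u w : ℝ) • ((1, 0) : ℝ × ℝ) + (inner ℝ v w : ℝ) • ((0, 1) : ℝ × ℝ) := by
      simp
    rw [innerSL_apply_apply]
    simp only [ContinuousLinearMap.comp_apply, ContinuousLinearMap.prod_apply,
      innerSL_apply_apply, h3, map_add, map_smul, smul_eq_mul]
    rw [inner_add_left, real_inner_smul_left, real_inner_smul_left]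
    ring
  rw [h1, charFunDual_map, h2, charFunDual_stdGaussian, innerSL_apply_norm]

/-- The pair of inner products of a standard Gaussian vector with two fixed vectors has a law that
depends only on the Gram matrix of the two vectors. -/
lemma stdGaussian_map_inner_pair {E F : Type*}
    [NormedAddCommGroup E] [InnerProductSpace ℝ E] [FiniteDimensional ℝ E]
    [MeasurableSpace E] [BorelSpace E]
    [NormedAddCommGroup F] [InnerProductSpace ℝ F] [FiniteDimensional ℝ F]
    [MeasurableSpace F] [BorelSpace F] (a b : E) (a' b' : F)
    (haa : ‖a‖ = ‖a'‖) (hbb : ‖b‖ = ‖b'‖) (hab : inner ℝ a b = inner ℝ a' b') :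
    (stdGaussian E).map (fun w => (inner ℝ a w, inner ℝ b w)) =
      (stdGaussian F).map (fun w => ((inner ℝ a' w, inner ℝ b' w) : ℝ × ℝ)) := by
  have hn : ∀ s t : ℝ, ‖s • a + t • b‖ = ‖s • a' + t • b'‖ := by
    intro s t
    rw [← sq_eq_sq₀ (norm_nonneg _) (norm_nonneg _), @norm_add_sq_real, @norm_add_sq_real]
    simp only [norm_smul, real_inner_smul_left, real_inner_smul_right, haa, hbb, hab]
  apply Measure.ext_of_charFunDual
  ext M
  rw [charFunDual_stdGaussian_map_inner_pair, charFunDual_stdGaussian_map_inner_pair, hn]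

/-- Only the Gram matrix matters, so `a` and `b` may be replaced by `‖a‖ (1, 0)` and `‖b‖ (cos θ,
sin θ)` in the plane. This removes the dimension, which is the growing width, from all Gaussian
expectations. -/
lemma pi_gaussian_map_pair {ι : Type*} [Fintype ι] (a b : EuclideanSpace ℝ ι) :
    (Measure.pi (fun _ : ι => gaussianReal 0 1)).map (fun w => (∑ j, w j * a j, ∑ j, w j * b j)) =
      ((gaussianReal 0 1).prod (gaussianReal 0 1)).map
        (fun p => (‖a‖ * p.1, ‖b‖ * (cos (angle a b) * p.1 + sin (angle a b) * p.2))) := by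
  set θ := angle a b with hθ
  set a' : EuclideanSpace ℝ (Fin 2) := !₂[‖a‖, 0] with ha'
  set b' : EuclideanSpace ℝ (Fin 2) := !₂[‖b‖ * cos θ, ‖b‖ * sin θ] with hb'
  have haa : ‖a‖ = ‖a'‖ := by
    rw [← sq_eq_sq₀ (norm_nonneg _) (norm_nonneg _), EuclideanSpace.real_norm_sq_eq a']
    simp [ha']
  have hbb : ‖b‖ = ‖b'‖ := by
    rw [← sq_eq_sq₀ (norm_nonneg _) (norm_nonneg _), EuclideanSpace.real_norm_sq_eq b']
    simp only [hb', Fin.sum_univ_two, Matrix.cons_val_zero, Matrix.cons_val_one]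
    have := sin_sq_add_cos_sq θ
    linear_combination (-‖b‖ ^ 2) * this
  have hab : inner ℝ a b = inner ℝ a' b' := by
    rw [← cos_angle_mul_norm_mul_norm a b]
    simp [ha', hb', PiLp.inner_apply, Fin.sum_univ_two]
    ring
  have h := stdGaussian_map_inner_pair a b a' b' haa hbb hab
  rw [← map_pi_eq_stdGaussian, ← map_pi_eq_stdGaussian,
    Measure.map_map (by fun_prop) (by fun_prop), Measure.map_map (by fun_prop) (by fun_prop)] at h
  have h1 : ((fun w : EuclideanSpace ℝ ι => ((inner ℝ a w, inner ℝ b w) : ℝ × ℝ)) ∘ WithLp.toLp 2)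
      = fun w => (∑ j, w j * a j, ∑ j, w j * b j) := by
    ext w <;> simp [PiLp.inner_apply]
  rw [h1] at h
  rw [h, ← (measurePreserving_finTwoArrow (gaussianReal 0 1)).map_eq,
    Measure.map_map (by fun_prop) (MeasurableEquiv.measurable _)]
  congr 1
  ext w <;> simp [PiLp.inner_apply, ha', hb', Fin.sum_univ_two, MeasurableEquiv.finTwoArrow]
  all_goals ring

lemma gaussianPDFReal_mul_polar (r t : ℝ) :
    gaussianPDFReal 0 1 (r * cos t) * gaussianPDFReal 0 1 (r * sin t) =
      (2 * π)⁻¹ * exp (-(1 / 2) * r ^ (2 : ℝ)) := by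
  simp only [gaussianPDFReal, NNReal.coe_one, mul_one, sub_zero]
  rw [mul_mul_mul_comm, ← exp_add, ← mul_inv, Real.mul_self_sqrt (by positivity)]
  congr 2
  rw [rpow_two]
  linear_combination (-(r ^ 2) / 2) * (sin_sq_add_cos_sq t)

/-- The Gaussian integral of a function on the plane that is homogeneous of degree `k`. -/
lemma integral_gaussian_prod_homogeneous (k : ℕ) (f : ℝ × ℝ → ℝ) (h : ℝ → ℝ)
    (hf : ∀ r t : ℝ, 0 < r → f (r * cos t, r * sin t) = r ^ k * h t) :
    ∫ p, f p ∂((gaussianReal 0 1).prod (gaussianReal 0 1)) =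
      (2 * π)⁻¹ * (∫ r in Ioi (0 : ℝ), r ^ ((k : ℝ) + 1) * exp (-(1 / 2) * r ^ (2 : ℝ))) *
        ∫ t in Ioo (-π) π, h t := by
  have hd : (gaussianReal 0 1).prod (gaussianReal 0 1) =
      (volume : Measure (ℝ × ℝ)).withDensity
        (fun p => gaussianPDF 0 1 p.1 * gaussianPDF 0 1 p.2) := by
    rw [gaussianReal_of_var_ne_zero 0 one_ne_zero,
      prod_withDensity (measurable_gaussianPDF 0 1) (measurable_gaussianPDF 0 1)]
    rfl
  have hm : Measurable fun p : ℝ × ℝ => gaussianPDF 0 1 p.1 * gaussianPDF 0 1 p.2 :=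
    ((measurable_gaussianPDF 0 1).comp measurable_fst).mul
      ((measurable_gaussianPDF 0 1).comp measurable_snd)
  rw [hd, integral_withDensity_eq_integral_toReal_smul hm
    (ae_of_all _ fun _ => ENNReal.mul_lt_top gaussianPDF_lt_top gaussianPDF_lt_top),
    ← integral_comp_polarCoord_symm]
  -- The factor `p.1` is the polar Jacobian; it raises the exponent of the radius from `k` to `k +
  -- 1`.
  have h1 : ∀ p ∈ polarCoord.target, p.1 • (((gaussianPDF 0 1 (polarCoord.symm p).1 *
      gaussianPDF 0 1 (polarCoord.symm p).2).toReal) • f (polarCoord.symm p)) =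
      (2 * π)⁻¹ * ((p.1 ^ ((k : ℝ) + 1) * exp (-(1 / 2) * p.1 ^ (2 : ℝ))) * h p.2) := by
    rintro ⟨r, t⟩ hp
    have hr : 0 < r := by
      simpa using hp.1
    simp only [polarCoord_symm_apply, ENNReal.toReal_mul, toReal_gaussianPDF, smul_eq_mul,
      gaussianPDFReal_mul_polar, hf r t hr]
    rw [rpow_add_one hr.ne', rpow_natCast]
    ring
  rw [setIntegral_congr_fun polarCoord.open_target.measurableSet h1, integral_const_mul,
    polarCoord_target, Measure.volume_eq_prod,
    setIntegral_prod_mul (fun r : ℝ => r ^ ((k : ℝ) + 1) * exp (-(1 / 2) * r ^ (2 : ℝ))) h]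
  ring

/-! ### Arc-cosine kernels by angular integration. -/

lemma integral_radial_one :
    ∫ r in Ioi (0 : ℝ), r ^ (((0 : ℕ) : ℝ) + 1) * exp (-(1 / 2) * r ^ (2 : ℝ)) = 1 := by
  rw [integral_rpow_mul_exp_neg_mul_rpow (by norm_num) (by norm_num) (by norm_num)]
  norm_num

lemma integral_radial_three :
    ∫ r in Ioi (0 : ℝ), r ^ (((2 : ℕ) : ℝ) + 1) * exp (-(1 / 2) * r ^ (2 : ℝ)) = 2 := by
  rw [integral_rpow_mul_exp_neg_mul_rpow (by norm_num) (by norm_num) (by norm_num)]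
  norm_num

/-- Two open half-circles whose axes enclose the angle `θ` meet in a single arc of length `π - θ`.
Both ReLU units are active exactly on this arc. -/
lemma cos_pos_and_cos_sub_pos_iff {θ t : ℝ} (h0 : 0 ≤ θ) (h1 : θ ≤ π) (ht : t ∈ Ioo (-π) π) :
    (0 < cos t ∧ 0 < cos (t - θ)) ↔ t ∈ Ioo (θ - π / 2) (π / 2) := by
  obtain ⟨h2, h3⟩ := ht
  constructor
  · rintro ⟨h4, h5⟩
    have h6 : t < π / 2 := by
      by_contra! h
      linarith [cos_nonpos_of_pi_div_two_le_of_le h (by linarith)]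
    have h7 : -(π / 2) < t := by
      by_contra! h
      have := cos_nonpos_of_pi_div_two_le_of_le (x := -t) (by linarith) (by linarith)
      rw [cos_neg] at this
      linarith
    refine ⟨?_, h6⟩
    by_contra! h
    have := cos_nonpos_of_pi_div_two_le_of_le (x := θ - t) (by linarith) (by linarith)
    rw [← cos_neg, neg_sub] at this
    linarith
  · rintro ⟨h4, h5⟩
    exact ⟨cos_pos_of_mem_Ioo ⟨by linarith, by linarith⟩,
      cos_pos_of_mem_Ioo ⟨by linarith, by linarith⟩⟩

lemma setIntegral_angular {θ : ℝ} (h0 : 0 ≤ θ) (h1 : θ ≤ π) (h g : ℝ → ℝ)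
    (hpos : ∀ t, 0 < cos t ∧ 0 < cos (t - θ) → h t = g t)
    (hneg : ∀ t, ¬ (0 < cos t ∧ 0 < cos (t - θ)) → h t = 0) :
    ∫ t in Ioo (-π) π, h t = ∫ t in (θ - π / 2)..(π / 2), g t := by
  rw [intervalIntegral.integral_of_le (by linarith), ← integral_Ioc_eq_integral_Ioo,
    integral_Ioc_eq_integral_Ioo, integral_Ioc_eq_integral_Ioo]
  have hsub : Ioo (θ - π / 2) (π / 2) ⊆ Ioo (-π) π := by
    intro t ht
    exact ⟨by linarith [ht.1, pi_pos], by linarith [ht.2, pi_pos]⟩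
  rw [setIntegral_eq_of_subset_of_forall_sdiff_eq_zero measurableSet_Ioo hsub]
  · refine setIntegral_congr_fun measurableSet_Ioo fun t ht => ?_
    exact hpos t ((cos_pos_and_cos_sub_pos_iff h0 h1 (hsub ht)).2 ht)
  · rintro t ⟨ht, ht'⟩
    exact hneg t fun h => ht' ((cos_pos_and_cos_sub_pos_iff h0 h1 ht).1 h)

/-- The normalized arc-cosine kernel of degree one, as a function of the cosine of the angle. -/
def arccosKernelOne (ρ : ℝ) : ℝ := (√(1 - ρ ^ 2) + (π - arccos ρ) * ρ) / π

/-- The normalized arc-cosine kernel of degree zero, as a function of the cosine of the angle. -/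
def arccosKernelZero (ρ : ℝ) : ℝ := 1 - arccos ρ / π

lemma arccosKernelOne_cos {θ : ℝ} (h0 : 0 ≤ θ) (h1 : θ ≤ π) :
    arccosKernelOne (cos θ) = (sin θ + (π - θ) * cos θ) / π := by
  rw [arccosKernelOne, arccos_cos h0 h1, ← sin_sq, sqrt_sq (sin_nonneg_of_nonneg_of_le_pi h0 h1)]

lemma integral_cos_mul_cos_sub (θ : ℝ) :
    ∫ t in (θ - π / 2)..(π / 2), cos t * cos (t - θ) = (sin θ + (π - θ) * cos θ) / 2 := by
  -- The antiderivative comes from `cos t * cos (t - θ) = (cos (2 * t - θ) + cos θ) / 2`.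
  have h : ∀ t ∈ uIcc (θ - π / 2) (π / 2),
      HasDerivAt (fun t => (sin (2 * t - θ) / 2 + t * cos θ) / 2) (cos t * cos (t - θ)) t := by
    intro t _
    have h1 : HasDerivAt (fun t : ℝ => 2 * t - θ) 2 t := by
      simpa using ((hasDerivAt_id t).const_mul 2).sub_const θ
    have h2 := (((h1.sin).div_const 2).add ((hasDerivAt_id t).mul_const (cos θ))).div_const 2
    convert! h2 using 1
    have h3 : cos (2 * t - θ) = cos t * cos (t - θ) - sin t * sin (t - θ) := by
      rw [← cos_add]; congr 1; ring
    have h4 : cos θ = cos t * cos (t - θ) + sin t * sin (t - θ) := by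
      rw [← cos_sub]; congr 1; ring
    rw [h3]
    linear_combination (-1 / 2) * h4
  rw [intervalIntegral.integral_eq_sub_of_hasDerivAt h
    (Continuous.intervalIntegrable (by fun_prop) _ _)]
  have h5 : sin (2 * (π / 2) - θ) = sin θ := by
    rw [show 2 * (π / 2) - θ = π - θ by ring, sin_pi_sub]
  have h6 : sin (2 * (θ - π / 2) - θ) = - sin θ := by
    rw [show 2 * (θ - π / 2) - θ = θ - π by ring, sin_sub_pi]
  rw [h5, h6]
  ring

/-- The derivative of the ReLU activation away from zero. -/
def reluDeriv (t : ℝ) : ℝ := if 0 < t then 1 else 0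

lemma measurable_reluDeriv : Measurable reluDeriv :=
  Measurable.ite measurableSet_Ioi measurable_const measurable_const

lemma integral_pi_gaussian_pair {ι : Type*} [Fintype ι] (a b : EuclideanSpace ℝ ι)
    (g : ℝ → ℝ → ℝ) (hg : Measurable (Function.uncurry g)) :
    ∫ w, g (∑ j, w j * a j) (∑ j, w j * b j) ∂(Measure.pi (fun _ : ι => gaussianReal 0 1)) =
      ∫ p, g (‖a‖ * p.1) (‖b‖ * (cos (angle a b) * p.1 + sin (angle a b) * p.2))
        ∂((gaussianReal 0 1).prod (gaussianReal 0 1)) := by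
  have h := pi_gaussian_map_pair a b
  have h1 := integral_map (μ := Measure.pi (fun _ : ι => gaussianReal 0 1))
    (φ := fun w => (∑ j, w j * a j, ∑ j, w j * b j)) (f := Function.uncurry g)
    (by fun_prop) (hg.aestronglyMeasurable)
  have h2 := integral_map (μ := (gaussianReal 0 1).prod (gaussianReal 0 1))
    (φ := fun p => (‖a‖ * p.1, ‖b‖ * (cos (angle a b) * p.1 + sin (angle a b) * p.2)))
    (f := Function.uncurry g) (by fun_prop) (hg.aestronglyMeasurable)
  rw [h] at h1
  exact h1.symm.trans h2

/-- In the plane the integrand is homogeneous of degree two and supported on the arc where both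
units are active. The final `1 / 2` is what `c ^ 2 = 2` cancels. -/
lemma integral_relu_mul_relu {ι : Type*} [Fintype ι] (a b : EuclideanSpace ℝ ι) :
    ∫ w, max 0 (∑ j, w j * a j) * max 0 (∑ j, w j * b j)
      ∂(Measure.pi (fun _ : ι => gaussianReal 0 1)) =
      ‖a‖ * ‖b‖ * arccosKernelOne (cos (angle a b)) / 2 := by
  rw [integral_pi_gaussian_pair a b (fun s t => max 0 s * max 0 t) (by fun_prop)]
  have h0 := angle_nonneg a b
  have h1 := angle_le_pi a b
  set θ := angle a b
  rw [integral_gaussian_prod_homogeneous 2 _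
    (fun t => ‖a‖ * ‖b‖ * (max 0 (cos t) * max 0 (cos (t - θ)))), integral_radial_three,
    integral_const_mul, setIntegral_angular h0 h1 _ (fun t => cos t * cos (t - θ)),
    integral_cos_mul_cos_sub, arccosKernelOne_cos h0 h1]
  · field_simp
  · rintro t ⟨h2, h3⟩
    simp only [max_eq_right h2.le, max_eq_right h3.le]
  · intro t ht
    by_cases h2 : 0 < cos t
    · have h3 : cos (t - θ) ≤ 0 := by
        by_contra! h
        exact ht ⟨h2, h⟩
      simp [max_eq_left h3]
    · simp [max_eq_left (not_lt.1 h2)]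
  · intro r t hr
    have hmax : ∀ s u : ℝ, 0 ≤ s → max 0 (s * u) = s * max 0 u := by
      intro s u hs
      rw [mul_max_of_nonneg _ _ hs, mul_zero]
    have h2 : ‖b‖ * (cos θ * (r * cos t) + sin θ * (r * sin t)) = ‖b‖ * (r * cos (t - θ)) := by
      rw [cos_sub]; ring
    simp only [h2]
    rw [hmax _ _ (norm_nonneg a), hmax _ _ (norm_nonneg b), hmax _ _ hr.le, hmax _ _ hr.le]
    ring

/-- The same computation in degree zero measures the arc. The vectors must be nonzero, since
`reluDeriv` is invariant only under positive scaling. -/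
lemma integral_reluDeriv_mul_reluDeriv {ι : Type*} [Fintype ι] {a b : EuclideanSpace ℝ ι}
    (ha : a ≠ 0) (hb : b ≠ 0) :
    ∫ w, reluDeriv (∑ j, w j * a j) * reluDeriv (∑ j, w j * b j)
      ∂(Measure.pi (fun _ : ι => gaussianReal 0 1)) = arccosKernelZero (cos (angle a b)) / 2 := by
  rw [integral_pi_gaussian_pair a b (fun s t => reluDeriv s * reluDeriv t)
    ((measurable_reluDeriv.comp measurable_fst).mul (measurable_reluDeriv.comp measurable_snd))]
  have h0 := angle_nonneg a b
  have h1 := angle_le_pi a b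
  set θ := angle a b
  rw [integral_gaussian_prod_homogeneous 0 _
    (fun t => reluDeriv (cos t) * reluDeriv (cos (t - θ))), integral_radial_one,
    setIntegral_angular h0 h1 _ (fun _ => 1), arccosKernelZero, arccos_cos h0 h1]
  · simp only [intervalIntegral.integral_const, smul_eq_mul]
    field_simp
    ring
  · rintro t ⟨h2, h3⟩
    simp [reluDeriv, h2, h3]
  · intro t ht
    by_cases h2 : 0 < cos t
    · have h3 : ¬ 0 < cos (t - θ) := fun h => ht ⟨h2, h⟩
      simp [reluDeriv, h3]
    · simp [reluDeriv, h2]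
  · intro r t hr
    have hpos : ∀ s u : ℝ, 0 < s → reluDeriv (s * u) = reluDeriv u := by
      intro s u hs
      simp [reluDeriv, mul_pos_iff_of_pos_left hs]
    have h2 : ‖b‖ * (cos θ * (r * cos t) + sin θ * (r * sin t)) = ‖b‖ * (r * cos (t - θ)) := by
      rw [cos_sub]; ring
    simp only [h2]
    rw [hpos _ _ (norm_pos_iff.2 ha), hpos _ _ (norm_pos_iff.2 hb), hpos _ _ hr, hpos _ _ hr]
    simp

/-- Used to keep the preactivations away from the kink of the activation. -/
lemma pi_gaussian_sum_eq_zero {ι : Type*} [Fintype ι] {a : EuclideanSpace ℝ ι} (ha : a ≠ 0) :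
    (Measure.pi (fun _ : ι => gaussianReal 0 1)) {w | ∑ j, w j * a j = 0} = 0 := by
  have h := pi_gaussian_map_pair a a
  have h1 : MeasurableSet {p : ℝ × ℝ | p.1 = 0} := measurable_fst (measurableSet_singleton 0)
  have h2 := congrArg (fun μ => μ {p : ℝ × ℝ | p.1 = 0}) h
  rw [Measure.map_apply (by fun_prop) h1, Measure.map_apply (by fun_prop) h1] at h2
  have h3 : (fun p : ℝ × ℝ => (‖a‖ * p.1, ‖a‖ * (cos (angle a a) * p.1 + sin (angle a a) * p.2)))
      ⁻¹' {p : ℝ × ℝ | p.1 = 0} = {(0 : ℝ)} ×ˢ univ := by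
    ext p
    simp [ha]
  have := nullSingletonClass_gaussianReal (μ := 0) (v := 1) one_ne_zero
  rw [h3, Measure.prod_prod, measure_singleton, zero_mul] at h2
  exact h2

/-! ### Convergence in probability as convergence along a filter. -/

/-- The filter of events of asymptotically full probability in a sequence of measure spaces.
Convergence in probability is convergence along this filter. -/
def whp {Ω : ℕ → Type*} [∀ m, MeasurableSpace (Ω m)] (μ : ∀ m, Measure (Ω m)) :
    Filter (Σ m, Ω m) where
  sets := {S | Tendsto (fun m => μ m {w | (⟨m, w⟩ : Σ m, Ω m) ∉ S}) atTop (𝓝 0)}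
  univ_sets := by simp
  sets_of_superset := by
    intro S T hS hST
    exact tendsto_of_tendsto_of_tendsto_of_le_of_le tendsto_const_nhds hS (fun _ => zero_le)
      (fun m => measure_mono fun w hw h => hw (hST h))
  inter_sets := by
    intro S T hS hT
    have h := Tendsto.add hS hT
    rw [add_zero] at h
    refine tendsto_of_tendsto_of_tendsto_of_le_of_le tendsto_const_nhds h (fun _ => zero_le)
      (fun m => (measure_mono ?_).trans (measure_union_le _ _))
    intro w hw
    by_contra h
    simp only [mem_union, mem_ofPred_eq, not_or, not_not] at h
    exact hw ⟨h.1, h.2⟩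

section Whp

variable {Ω : ℕ → Type*} [∀ m, MeasurableSpace (Ω m)] {μ : ∀ m, Measure (Ω m)}

lemma eventually_whp {p : (Σ m, Ω m) → Prop} :
    (∀ᶠ x in whp μ, p x) ↔ Tendsto (fun m => μ m {w | ¬ p ⟨m, w⟩}) atTop (𝓝 0) := Iff.rfl

lemma tendsto_fst_whp : Tendsto Sigma.fst (whp μ) atTop := by
  intro S hS
  change Tendsto (fun m => μ m {w | m ∉ S}) atTop (𝓝 0)
  refine tendsto_const_nhds.congr' ?_
  filter_upwards [hS] with m hm
  simp [hm]

end Whp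

/-! ### Conditioning on a set of coordinates by resampling the others. -/

section Resample

variable {ι : Type*} [Fintype ι] (ν : ι → Measure ℝ) [∀ i, IsProbabilityMeasure (ν i)]

open Classical in
/-- Replacing a block of coordinates by an independent copy preserves a product measure. -/
lemma measurePreserving_piecewise (s : Set ι) :
    MeasurePreserving (fun p : (ι → ℝ) × (ι → ℝ) => s.piecewise p.2 p.1)
      ((Measure.pi ν).prod (Measure.pi ν)) (Measure.pi ν) := by
  have hm : Measurable (fun p : (ι → ℝ) × (ι → ℝ) => s.piecewise p.2 p.1) := by
    refine measurable_pi_lambda _ fun i => ?_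
    by_cases h : i ∈ s
    · simp only [Set.piecewise, h, if_true]
      fun_prop
    · simp only [Set.piecewise, h, if_false]
      fun_prop
  refine ⟨hm, ?_⟩
  symm
  refine Measure.pi_eq fun t ht => ?_
  rw [Measure.map_apply hm (MeasurableSet.univ_pi ht)]
  have h : (fun p : (ι → ℝ) × (ι → ℝ) => s.piecewise p.2 p.1) ⁻¹' univ.pi t =
      (univ.pi fun i => if i ∈ s then univ else t i) ×ˢ
        (univ.pi fun i => if i ∈ s then t i else univ) := by
    ext p
    simp only [mem_preimage, mem_univ_pi, mem_prod, ← forall_and]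
    refine forall_congr' fun i => ?_
    by_cases h : i ∈ s <;> simp [h]
  rw [h, Measure.prod_prod, Measure.pi_pi, Measure.pi_pi, ← Finset.prod_mul_distrib]
  refine Finset.prod_congr rfl fun i _ => ?_
  by_cases h : i ∈ s <;> simp [h]

-- Fubini for `measurePreserving_piecewise`. The inner measure is the conditional probability of `E`
-- given the coordinates outside `s`, so no abstract conditional expectation is needed.
open Classical in
lemma measure_pi_eq_lintegral_piecewise (s : Set ι) {E : Set (ι → ℝ)} (hE : MeasurableSet E) :
    Measurable (fun w => Measure.pi ν {w' | s.piecewise w' w ∈ E}) ∧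
    Measure.pi ν E = ∫⁻ w, Measure.pi ν {w' | s.piecewise w' w ∈ E} ∂(Measure.pi ν) := by
  have h := measurePreserving_piecewise ν s
  have hE' := h.measurable hE
  refine ⟨measurable_measure_prodMk_left hE', ?_⟩
  rw [← h.measure_preimage hE.nullMeasurableSet, Measure.prod_apply hE']
  rfl

end Resample

section ResampleWhp

variable {ι : ℕ → Type*} [∀ m, Fintype (ι m)] {ν : ∀ m, ι m → Measure ℝ}
  [∀ m i, IsProbabilityMeasure (ν m i)]

-- Law of total probability: the conditional probability is at most `η / 2` off an event of
-- probability `η / 2`, and at most `1` on that event.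
open Classical in
lemma eventually_whp_of_piecewise (s : ∀ m, Set (ι m)) (E : ∀ m, Set (ι m → ℝ))
    (hE : ∀ m, MeasurableSet (E m))
    (h : Tendsto (fun x : Σ m, (ι m → ℝ) =>
      Measure.pi (ν x.1) {w' | (s x.1).piecewise w' x.2 ∈ E x.1})
      (whp fun m => Measure.pi (ν m)) (𝓝 0)) :
    ∀ᶠ x in whp fun m => Measure.pi (ν m), x.2 ∉ E x.1 := by
  rw [eventually_whp]
  simp only [not_not]
  rw [ENNReal.tendsto_nhds_zero]
  intro η hη
  have hη2 : 0 < η / 2 := ENNReal.half_pos hη.ne'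
  have h1 : ∀ᶠ x in whp fun m => Measure.pi (ν m),
      Measure.pi (ν x.1) {w' | (s x.1).piecewise w' x.2 ∈ E x.1} ≤ η / 2 :=
    (ENNReal.tendsto_nhds_zero.1 h) _ hη2
  rw [eventually_whp, ENNReal.tendsto_nhds_zero] at h1
  filter_upwards [h1 _ hη2] with m hm
  obtain ⟨hg, he⟩ := measure_pi_eq_lintegral_piecewise (ν m) (s m) (hE m)
  set g := fun w => Measure.pi (ν m) {w' | (s m).piecewise w' w ∈ E m} with hgdef
  have hS : MeasurableSet {w | ¬ g w ≤ η / 2} := (measurableSet_le hg measurable_const).compl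
  calc Measure.pi (ν m) (E m) = ∫⁻ w, g w ∂(Measure.pi (ν m)) := he
    _ ≤ ∫⁻ w, (η / 2 + indicator {w | ¬ g w ≤ η / 2} 1 w) ∂(Measure.pi (ν m)) := by
        refine lintegral_mono fun w => ?_
        by_cases hw : g w ≤ η / 2
        · exact hw.trans le_self_add
        · have h2 : w ∈ {w | ¬ g w ≤ η / 2} := hw
          rw [indicator_of_mem h2]
          exact prob_le_one.trans le_add_self
    _ = η / 2 + Measure.pi (ν m) {w | ¬ g w ≤ η / 2} := by
        rw [lintegral_add_left measurable_const, lintegral_indicator_one hS]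
        simp
    _ ≤ η / 2 + η / 2 := by gcongr
    _ = η := ENNReal.add_halves η

open Classical in
/-- A nonnegative random variable tends to zero in probability if its conditional expectation,
given the coordinates outside a block, does. -/
lemma tendsto_whp_zero_of_piecewise (s : ∀ m, Set (ι m)) (Y : ∀ m, (ι m → ℝ) → ℝ)
    (hY : ∀ m, Measurable (Y m)) (hY0 : ∀ m w, 0 ≤ Y m w) (B : (Σ m, (ι m → ℝ)) → ℝ)
    (hB : Tendsto B (whp fun m => Measure.pi (ν m)) (𝓝 0))
    (h : ∀ᶠ x in whp fun m => Measure.pi (ν m),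
      Integrable (fun w' => Y x.1 ((s x.1).piecewise w' x.2)) (Measure.pi (ν x.1)) ∧
      ∫ w', Y x.1 ((s x.1).piecewise w' x.2) ∂(Measure.pi (ν x.1)) ≤ B x) :
    Tendsto (fun x : Σ m, (ι m → ℝ) => Y x.1 x.2) (whp fun m => Measure.pi (ν m)) (𝓝 0) := by
  rw [Metric.tendsto_nhds]
  intro ε hε
  have hE : ∀ m, MeasurableSet {w | ε ≤ Y m w} := fun m => measurableSet_le measurable_const (hY m)
  have key := eventually_whp_of_piecewise (ν := ν) s (fun m => {w | ε ≤ Y m w}) hE ?_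
  · filter_upwards [key] with x hx
    simp only [not_le] at hx
    rwa [dist_zero_right, Real.norm_eq_abs, abs_of_nonneg (hY0 _ _)]
  · have h0 : Tendsto (fun x => ENNReal.ofReal (B x / ε)) (whp fun m => Measure.pi (ν m)) (𝓝 0) := by
      have := (ENNReal.continuous_ofReal.tendsto _).comp (hB.div_const ε)
      simpa [Function.comp_def] using this
    refine tendsto_of_tendsto_of_tendsto_of_le_of_le' tendsto_const_nhds h0
      (Eventually.of_forall fun _ => zero_le) ?_
    filter_upwards [h] with x hx
    have h1 := mul_meas_ge_le_integral_of_nonneg (ae_of_all _ fun w' => hY0 x.1 _) hx.1 ε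
    rw [← ENNReal.ofReal_toReal (measure_ne_top _ _)]
    refine ENNReal.ofReal_le_ofReal ?_
    rw [le_div_iff₀ hε, mul_comm]
    exact h1.trans hx.2

-- Conditional Chebyshev inequality, in the form applied to centred statistics of one layer.
open Classical in
lemma tendsto_whp_zero_of_piecewise_sq (s : ∀ m, Set (ι m)) (Y : ∀ m, (ι m → ℝ) → ℝ)
    (hY : ∀ m, Measurable (Y m)) (B : (Σ m, (ι m → ℝ)) → ℝ)
    (hB : Tendsto B (whp fun m => Measure.pi (ν m)) (𝓝 0))
    (h : ∀ᶠ x in whp fun m => Measure.pi (ν m),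
      Integrable (fun w' => Y x.1 ((s x.1).piecewise w' x.2) ^ 2) (Measure.pi (ν x.1)) ∧
      ∫ w', Y x.1 ((s x.1).piecewise w' x.2) ^ 2 ∂(Measure.pi (ν x.1)) ≤ B x) :
    Tendsto (fun x : Σ m, (ι m → ℝ) => Y x.1 x.2) (whp fun m => Measure.pi (ν m)) (𝓝 0) := by
  have h1 := tendsto_whp_zero_of_piecewise s (fun m w => Y m w ^ 2) (fun m => (hY m).pow_const 2)
    (fun _ _ => sq_nonneg _) B hB h
  have h2 := (continuous_sqrt.tendsto _).comp h1
  simp only [sqrt_zero] at h2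
  rw [tendsto_zero_iff_abs_tendsto_zero]
  refine h2.congr fun x => ?_
  simp [sqrt_sq_eq_abs]

end ResampleWhp

/-! ### Gaussian moments up to order four. -/

section Moments

lemma integral_pow_gaussianReal_one : ∫ x, x ^ 1 ∂(gaussianReal 0 1) = 0 := by
  simp

lemma integral_pow_gaussianReal_two : ∫ x, x ^ 2 ∂(gaussianReal 0 1) = 1 := by
  have h := variance_fun_id_gaussianReal (μ := 0) (v := 1)
  rw [variance_eq_integral (by fun_prop)] at h
  simpa using h

lemma integral_pow_gaussianReal_three : ∫ x, x ^ 3 ∂(gaussianReal 0 1) = 0 := by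
  have h1 : ∫ x, x ^ 3 ∂((gaussianReal 0 1).map fun x => -x) = - ∫ x, x ^ 3 ∂(gaussianReal 0 1) := by
    rw [integral_map (by fun_prop) (by fun_prop), ← integral_neg]
    congr 1
    ext x
    ring
  rw [gaussianReal_map_neg, neg_zero] at h1
  linarith

/-- The polar formula in degree four gives `(2π)⁻¹ * 8 * (3π / 4)`. -/
lemma integral_pow_gaussianReal_four : ∫ x, x ^ 4 ∂(gaussianReal 0 1) = 3 := by
  have h1 : ∫ r in Ioi (0 : ℝ), r ^ (((4 : ℕ) : ℝ) + 1) * exp (-(1 / 2) * r ^ (2 : ℝ)) = 8 := by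
    rw [integral_rpow_mul_exp_neg_mul_rpow (by norm_num) (by norm_num) (by norm_num)]
    norm_num
  have h2 : ∫ t in Ioo (-π) π, cos t ^ 4 = 3 / 4 * π := by
    rw [← integral_Ioc_eq_integral_Ioo, ← intervalIntegral.integral_of_le (by linarith [pi_pos]),
      integral_cos_pow, integral_cos_sq]
    simp
    ring
  have h3 := integral_gaussian_prod_homogeneous 4 (fun p => p.1 ^ 4) (fun t => cos t ^ 4)
    (fun r t _ => by ring)
  rw [h1, h2, integral_fun_fst (μ := gaussianReal 0 1) (ν := gaussianReal 0 1)
    (fun x => x ^ 4)] at h3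
  simp only [probReal_univ, one_smul] at h3
  rw [h3]
  field_simp
  norm_num

lemma integrable_pow_gaussianReal (n : ℕ) : Integrable (fun x => x ^ n) (gaussianReal 0 1) := by
  have h := (memLp_id_gaussianReal (μ := 0) (v := 1) n).integrable_norm_pow'
  refine h.mono (by fun_prop) (ae_of_all _ fun x => ?_)
  simp

variable {ι : Type*} [Fintype ι]

lemma mul_four_eq_prod [DecidableEq ι] (w : ι → ℝ) (p q r s : ι) :
    w p * w q * w r * w s = ∏ i, w i ^ ((if i = p then 1 else 0) + (if i = q then 1 else 0) +
      (if i = r then 1 else 0) + (if i = s then 1 else 0)) := by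
  simp only [pow_add, Finset.prod_mul_distrib, Finset.prod_ite_eq',
    pow_ite, pow_one, pow_zero, Finset.mem_univ, if_true]

lemma integrable_mul_four (p q r s : ι) :
    Integrable (fun w : ι → ℝ => w p * w q * w r * w s)
      (Measure.pi fun _ => gaussianReal 0 1) := by
  classical
  simp_rw [mul_four_eq_prod _ p q r s]
  exact Integrable.fintype_prod (f := fun i x => x ^ _) (fun i => integrable_pow_gaussianReal _)

/-- Isserlis' formula for the fourth moments of independent standard Gaussians. -/
lemma integral_mul_four [DecidableEq ι] (p q r s : ι) :
    ∫ w : ι → ℝ, w p * w q * w r * w s ∂(Measure.pi fun _ => gaussianReal 0 1) =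
      (if p = q then 1 else 0) * (if r = s then 1 else 0) +
      (if p = r then 1 else 0) * (if q = s then 1 else 0) +
      (if p = s then 1 else 0) * (if q = r then 1 else 0) := by
  simp_rw [mul_four_eq_prod _ p q r s]
  rw [integral_fintype_prod_eq_prod (f := fun i x => x ^ _)]
  -- The product of moments sees only multiplicities: an odd one kills it, two distinct pairs give
  -- `1`, and a fourfold index gives `3`, one for each of the three pairings.
  have hz : ∀ (c : ι → ℕ) (i : ι), (c i = 1 ∨ c i = 3) →
      ∏ i, ∫ x, x ^ c i ∂(gaussianReal 0 1) = 0 := by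
    intro c i h
    refine Finset.prod_eq_zero (Finset.mem_univ i) ?_
    rcases h with h | h <;> rw [h]
    · exact integral_pow_gaussianReal_one
    · exact integral_pow_gaussianReal_three
  have ho : ∀ (c : ι → ℕ), (∀ i, c i = 0 ∨ c i = 2) →
      ∏ i, ∫ x, x ^ c i ∂(gaussianReal 0 1) = 1 := by
    intro c h
    refine Finset.prod_eq_one fun i _ => ?_
    rcases h i with h | h <;> rw [h]
    · simp
    · exact integral_pow_gaussianReal_two
  have h4 : ∀ (c : ι → ℕ) (i : ι), c i = 4 → (∀ j, j ≠ i → c j = 0) →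
      ∏ i, ∫ x, x ^ c i ∂(gaussianReal 0 1) = 3 := by
    intro c i h h'
    rw [Finset.prod_eq_single i, h, integral_pow_gaussianReal_four]
    · intro j _ hj
      simp [h' j hj]
    · simp
  by_cases hpq : p = q
  · subst hpq
    by_cases hrs : r = s
    · subst hrs
      by_cases hpr : p = r
      · subst hpr
        rw [h4 _ p (by simp) (by intro j hj; simp [hj])]
        norm_num
      · rw [ho]
        · simp [hpr]
        · intro i
          by_cases h1 : i = p
          · subst h1; simp [hpr]
          · by_cases h2 : i = r
            · subst h2; simp [h1]
            · simp [h1, h2]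
    · by_cases hpr : p = r
      · subst hpr
        rw [hz _ s (by simp [Ne.symm hrs])]
        simp [hrs]
      · rw [hz _ r (by simp [Ne.symm hpr, hrs])]
        simp [hrs, hpr]
  · by_cases hpr : p = r
    · subst hpr
      by_cases hqs : q = s
      · subst hqs
        rw [ho]
        · simp [hpq, Ne.symm hpq]
        · intro i
          by_cases h1 : i = p
          · subst h1; simp [hpq]
          · by_cases h2 : i = q
            · subst h2; simp [h1]
            · simp [h1, h2]
      · rw [hz _ q (by simp [Ne.symm hpq, hqs])]
        simp [hpq, hqs, Ne.symm hpq]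
    · by_cases hps : p = s
      · subst hps
        by_cases hqr : q = r
        · subst hqr
          rw [ho]
          · simp [hpq]
          · intro i
            by_cases h1 : i = p
            · subst h1; simp [hpq]
            · by_cases h2 : i = q
              · subst h2; simp [h1]
              · simp [h1, h2]
        · rw [hz _ q (by simp [Ne.symm hpq, hqr])]
          simp [hpq, hpr, hqr]
      · rw [hz _ p (by simp [hpq, hpr, hps])]
        simp [hpq, hpr, hps]

end Moments

/-! ### Mean and variance of Gaussian bilinear forms. -/

section QuadraticForms

variable {ι α β κ : Type*} [Fintype α] [Fintype β]

/-- The bilinear form with coefficients `A` evaluated at two blocks of coordinates of `w`. -/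
def blockForm (A : α → β → ℝ) (u : α → ι) (v : β → ι) (w : ι → ℝ) : ℝ :=
  ∑ a, ∑ b, A a b * (w (u a) * w (v b))

lemma blockForm_sq (A : α → β → ℝ) (u : α → ι) (v : β → ι) (w : ι → ℝ) :
    blockForm A u v w ^ 2 = ∑ a, ∑ b, ∑ a', ∑ b',
      A a b * A a' b' * (w (u a) * w (v b) * w (u a') * w (v b')) := by
  simp only [blockForm, sq, Finset.sum_mul, Finset.mul_sum]
  refine Finset.sum_congr rfl fun a _ => Finset.sum_congr rfl fun b _ =>
    Finset.sum_congr rfl fun a' _ => Finset.sum_congr rfl fun b' _ => by ring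

lemma measurable_blockForm (A : α → β → ℝ) (u : α → ι) (v : β → ι) :
    Measurable (blockForm A u v) := by
  unfold blockForm
  fun_prop

variable [Fintype ι]

lemma integrable_blockForm_sq (A : α → β → ℝ) (u : α → ι) (v : β → ι) :
    Integrable (fun w => blockForm A u v w ^ 2) (Measure.pi fun _ => gaussianReal 0 1) := by
  simp only [blockForm_sq]
  exact integrable_finsetSum _ fun a _ => integrable_finsetSum _ fun b _ =>
    integrable_finsetSum _ fun a' _ => integrable_finsetSum _ fun b' _ =>
      (integrable_mul_four _ _ _ _).const_mul _

lemma memLp_blockForm (A : α → β → ℝ) (u : α → ι) (v : β → ι) :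
    MemLp (blockForm A u v) 2 (Measure.pi fun _ => gaussianReal 0 1) :=
  (memLp_two_iff_integrable_sq (measurable_blockForm A u v).aestronglyMeasurable).2
    (integrable_blockForm_sq A u v)

lemma integral_blockForm_sq [DecidableEq ι] (A : α → β → ℝ) (u : α → ι) (v : β → ι) :
    ∫ w, blockForm A u v w ^ 2 ∂(Measure.pi fun _ => gaussianReal 0 1) =
      ∑ a, ∑ b, ∑ a', ∑ b', A a b * A a' b' *
        ((if u a = v b then 1 else 0) * (if u a' = v b' then 1 else 0) +
          (if u a = u a' then 1 else 0) * (if v b = v b' then 1 else 0) +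
          (if u a = v b' then 1 else 0) * (if v b = u a' then 1 else 0)) := by
  simp only [blockForm_sq]
  rw [integral_finsetSum _ fun a _ => integrable_finsetSum _ fun b _ =>
    integrable_finsetSum _ fun a' _ => integrable_finsetSum _ fun b' _ =>
      (integrable_mul_four _ _ _ _).const_mul _]
  refine Finset.sum_congr rfl fun a _ => ?_
  rw [integral_finsetSum _ fun b _ =>
    integrable_finsetSum _ fun a' _ => integrable_finsetSum _ fun b' _ =>
      (integrable_mul_four _ _ _ _).const_mul _]
  refine Finset.sum_congr rfl fun b _ => ?_
  rw [integral_finsetSum _ fun a' _ => integrable_finsetSum _ fun b' _ =>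
      (integrable_mul_four _ _ _ _).const_mul _]
  refine Finset.sum_congr rfl fun a' _ => ?_
  rw [integral_finsetSum _ fun b' _ => (integrable_mul_four _ _ _ _).const_mul _]
  refine Finset.sum_congr rfl fun b' _ => ?_
  rw [integral_const_mul, integral_mul_four]

variable {e : κ → α → ι}

/-- For two disjoint rows only the pairing of each row with itself survives in Isserlis' formula. -/
lemma integral_blockForm_sq_of_ne (he : Function.Injective2 e) (A : α → α → ℝ) {i j : κ}
    (hij : i ≠ j) :
    ∫ w, blockForm A (e i) (e j) w ^ 2 ∂(Measure.pi fun _ => gaussianReal 0 1) =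
      ∑ a, ∑ b, A a b ^ 2 := by
  classical
  rw [integral_blockForm_sq]
  simp only [he.eq_iff, hij, hij.symm, false_and, if_false, zero_mul, zero_add, add_zero, true_and]
  refine Finset.sum_congr rfl fun a _ => Finset.sum_congr rfl fun b _ => ?_
  rw [Finset.sum_eq_single a, Finset.sum_eq_single b]
  · simp [sq]
  · intro b' _ hb
    simp [hb.symm]
  · simp
  · intro a' _ ha
    simp [ha.symm]
  · simp

/-- On a single row all three pairings survive, giving the squared trace, the squared Frobenius norm
and the twisted sum in turn. -/
lemma integral_blockForm_sq_self (he : Function.Injective2 e) (A : α → α → ℝ) (i : κ) :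
    ∫ w, blockForm A (e i) (e i) w ^ 2 ∂(Measure.pi fun _ => gaussianReal 0 1) =
      (∑ a, A a a) ^ 2 + ∑ a, ∑ b, A a b ^ 2 + ∑ a, ∑ b, A a b * A b a := by
  classical
  rw [integral_blockForm_sq]
  simp only [he.eq_iff, true_and, mul_add, Finset.sum_add_distrib]
  congr 1
  · congr 1
    · simp only [sq, Finset.sum_mul, Finset.mul_sum]
      refine Finset.sum_congr rfl fun a _ => ?_
      rw [Finset.sum_eq_single a]
      · refine Finset.sum_congr rfl fun a' _ => ?_
        rw [Finset.sum_eq_single a']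
        · simp [mul_comm]
        · intro b _ hb
          simp [hb.symm]
        · simp
      · intro b _ hb
        simp [hb.symm]
      · simp
    · refine Finset.sum_congr rfl fun a _ => Finset.sum_congr rfl fun b _ => ?_
      rw [Finset.sum_eq_single a, Finset.sum_eq_single b]
      · simp [sq]
      · intro b' _ hb
        simp [hb.symm]
      · simp
      · intro a' _ ha
        simp [ha.symm]
      · simp
  · refine Finset.sum_congr rfl fun a _ => Finset.sum_congr rfl fun b _ => ?_
    rw [Finset.sum_eq_single b, Finset.sum_eq_single a]
    · simp
    · intro b' _ hb
      simp [hb.symm]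
    · simp
    · intro a' _ ha
      simp [ha.symm]
    · simp

lemma integral_mul_two [DecidableEq ι] (p q : ι) :
    ∫ w : ι → ℝ, w p * w q ∂(Measure.pi fun _ => gaussianReal 0 1) = if p = q then 1 else 0 := by
  by_cases h : p = q
  · subst h
    have h1 := integral_comp_eval (μ := fun _ : ι => gaussianReal 0 1) (i := p)
      (f := fun x : ℝ => x ^ 2) (by fun_prop)
    simp only [if_true, ← sq]
    rw [← integral_pow_gaussianReal_two, ← h1]
  · have h1 : iIndepFun (fun (i : ι) (w : ι → ℝ) => w i)
        (Measure.pi fun _ : ι => gaussianReal 0 1) :=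
      iIndepFun_pi (X := fun _ x => x) fun i => aemeasurable_id
    have h2 := (h1.indepFun h).integral_fun_mul_eq_mul_integral
      (measurable_pi_apply p).aestronglyMeasurable (measurable_pi_apply q).aestronglyMeasurable
    have h3 := integral_comp_eval (μ := fun _ : ι => gaussianReal 0 1) (i := p)
      (f := fun x : ℝ => x) (by fun_prop)
    simp only [h, if_false]
    rw [h2, h3]
    simp

lemma integral_blockForm_self (he : Function.Injective2 e) (A : α → α → ℝ) (i : κ) :
    ∫ w, blockForm A (e i) (e i) w ∂(Measure.pi fun _ => gaussianReal 0 1) = ∑ a, A a a := by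
  classical
  have hint : ∀ p q : ι, Integrable (fun w : ι → ℝ => w p * w q)
      (Measure.pi fun _ => gaussianReal 0 1) := by
    intro p q
    have h1 : ∀ p : ι, MemLp (fun w : ι → ℝ => w p) 2 (Measure.pi fun _ => gaussianReal 0 1) := by
      intro p
      rw [memLp_two_iff_integrable_sq (measurable_pi_apply p).aestronglyMeasurable]
      exact integrable_comp_eval (μ := fun _ : ι => gaussianReal 0 1) (i := p)
        (f := fun x : ℝ => x ^ 2) (integrable_pow_gaussianReal 2)
    exact (h1 p).integrable_mul (h1 q)
  simp only [blockForm]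
  rw [integral_finsetSum _ fun a _ => integrable_finsetSum _ fun b _ => (hint _ _).const_mul _]
  refine Finset.sum_congr rfl fun a _ => ?_
  rw [integral_finsetSum _ fun b _ => (hint _ _).const_mul _]
  simp only [integral_const_mul, integral_mul_two, he.eq_iff, true_and]
  simp

lemma sum_mul_swap_le (A : α → α → ℝ) : ∑ a, ∑ b, A a b * A b a ≤ ∑ a, ∑ b, A a b ^ 2 := by
  have h1 : ∑ a, ∑ b, A b a ^ 2 = ∑ a, ∑ b, A a b ^ 2 := Finset.sum_comm
  have h2 : ∑ a, ∑ b, A a b * A b a ≤ ∑ a, ∑ b, (A a b ^ 2 / 2 + A b a ^ 2 / 2) :=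
    Finset.sum_le_sum fun a _ => Finset.sum_le_sum fun b _ => by
      nlinarith [sq_nonneg (A a b - A b a)]
  simp only [Finset.sum_add_distrib, ← Finset.sum_div] at h2
  linarith

lemma integral_blockForm_sq_self_le (he : Function.Injective2 e) (A : α → α → ℝ) (i : κ) :
    ∫ w, blockForm A (e i) (e i) w ^ 2 ∂(Measure.pi fun _ => gaussianReal 0 1) ≤
      (∑ a, A a a) ^ 2 + 2 * ∑ a, ∑ b, A a b ^ 2 := by
  rw [integral_blockForm_sq_self he]
  linarith [sum_mul_swap_le A]

/-- The source of all concentration for gradients: the form has mean `tr A`, and subtracting the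
squared mean from the second moment leaves only Frobenius terms. A vanishing Frobenius norm thus
makes the form deterministic. -/
lemma integral_blockForm_sub_trace_sq_le (he : Function.Injective2 e) (A : α → α → ℝ) (i : κ) :
    ∫ w, (blockForm A (e i) (e i) w - ∑ a, A a a) ^ 2 ∂(Measure.pi fun _ => gaussianReal 0 1) ≤
      2 * ∑ a, ∑ b, A a b ^ 2 := by
  have h := variance_eq_integral (μ := Measure.pi fun _ : ι => gaussianReal 0 1)
    (measurable_blockForm A (e i) (e i)).aemeasurable
  rw [integral_blockForm_self he] at h
  rw [← h, variance_eq_sub (memLp_blockForm A (e i) (e i)), integral_blockForm_self he]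
  have := integral_blockForm_sq_self_le he A i
  simp only [Pi.pow_apply]
  linarith

end QuadraticForms

/-! ### Independence of the weight rows. -/

section Rows

variable {ι α κ : Type*} [Fintype ι] [Fintype α]

/-- Distinct blocks of coordinates are independent under a product measure. -/
lemma indepFun_blocks (ν : ι → Measure ℝ) [∀ i, IsProbabilityMeasure (ν i)] {e : κ → α → ι}
    (he : Function.Injective2 e) {i j : κ} (hij : i ≠ j) {f g : (α → ℝ) → ℝ} (hf : Measurable f)
    (hg : Measurable g) :
    IndepFun (fun w : ι → ℝ => f fun a => w (e i a)) (fun w => g fun a => w (e j a))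
      (Measure.pi ν) := by
  classical
  have h1 : iIndepFun (fun (i : ι) (w : ι → ℝ) => w i) (Measure.pi ν) :=
    iIndepFun_pi (X := fun _ x => x) fun i => aemeasurable_id
  have hd : Disjoint (Finset.univ.image (e i)) (Finset.univ.image (e j)) := by
    rw [Finset.disjoint_left]
    intro p hp hp'
    obtain ⟨a, _, rfl⟩ := Finset.mem_image.1 hp
    obtain ⟨b, _, hb⟩ := Finset.mem_image.1 hp'
    exact hij (he hb).1.symm
  have h2 := h1.indepFun_finset _ _ hd fun i => measurable_pi_apply i
  have hmem : ∀ (k : κ) (a : α), e k a ∈ Finset.univ.image (e k) := fun k a =>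
    Finset.mem_image_of_mem _ (Finset.mem_univ a)
  exact h2.comp
    (φ := fun v : (Finset.univ.image (e i) → ℝ) => f fun a => v ⟨e i a, hmem i a⟩)
    (ψ := fun v : (Finset.univ.image (e j) → ℝ) => g fun a => v ⟨e j a, hmem j a⟩)
    (hf.comp (by fun_prop)) (hg.comp (by fun_prop))

/-- A block of coordinates under a product of copies of one measure. -/
lemma measurePreserving_block (ν : Measure ℝ) [IsProbabilityMeasure ν] {e : κ → α → ι}
    (he : Function.Injective2 e) (i : κ) :
    MeasurePreserving (fun (w : ι → ℝ) a => w (e i a)) (Measure.pi fun _ => ν)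
      (Measure.pi fun _ => ν) := by
  have h1 : iIndepFun (fun (i : ι) (w : ι → ℝ) => w i) (Measure.pi fun _ : ι => ν) :=
    iIndepFun_pi (X := fun _ x => x) fun i => aemeasurable_id
  have h2 : iIndepFun (fun (a : α) (w : ι → ℝ) => w (e i a)) (Measure.pi fun _ : ι => ν) :=
    h1.precomp (he.right i)
  refine ⟨by fun_prop, ?_⟩
  rw [h2.map_fun_eq_pi_map (fun a => (measurable_pi_apply _).aemeasurable)]
  congr 1
  ext1 a
  exact (measurePreserving_eval (fun _ : ι => ν) (e i a)).map_eq

/-- The second moment of a normalized sum of pairwise independent variables. -/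
lemma integral_sum_sub_sq_le {Ω : Type*} [MeasurableSpace Ω] {μ : Measure Ω}
    [IsProbabilityMeasure μ] {κ : Type*} [Fintype κ] (X : κ → Ω → ℝ) (M V t : ℝ)
    (hX : ∀ i, MemLp (X i) 2 μ) (hM : ∀ i, ∫ ω, X i ω ∂μ = M) (hV : ∀ i, ∫ ω, X i ω ^ 2 ∂μ ≤ V)
    (hind : Pairwise fun i j => IndepFun (X i) (X j) μ) :
    Integrable (fun ω => (t * ∑ i, (X i ω - M)) ^ 2) μ ∧
    ∫ ω, (t * ∑ i, (X i ω - M)) ^ 2 ∂μ ≤ t ^ 2 * (Fintype.card κ * V) := by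
  have hsum : MemLp (∑ i, X i) 2 μ := memLp_finsetSum' _ fun i _ => hX i
  have hmean : ∫ ω, (∑ i, X i) ω ∂μ = ∑ i : κ, M := by
    simp only [Finset.sum_apply]
    rw [integral_finsetSum _ fun i _ => (hX i).integrable (by norm_num)]
    simp only [hM]
  have heq : ∀ ω, (t * ∑ i, (X i ω - M)) ^ 2 = t ^ 2 * ((∑ i, X i) ω - ∑ i : κ, M) ^ 2 := by
    intro ω
    rw [Finset.sum_sub_distrib, Finset.sum_apply, mul_pow]
  have hvar := IndepFun.variance_sum (s := Finset.univ) (fun i _ => hX i)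
    (fun i _ j _ hij => hind hij)
  rw [variance_eq_integral hsum.aestronglyMeasurable.aemeasurable, hmean] at hvar
  simp only [heq]
  refine ⟨((hsum.sub (memLp_const _)).integrable_sq).const_mul _, ?_⟩
  rw [integral_const_mul, hvar]
  refine mul_le_mul_of_nonneg_left ?_ (sq_nonneg t)
  rw [← nsmul_eq_mul, ← Finset.card_univ, ← Finset.sum_const]
  refine Finset.sum_le_sum fun i _ => ?_
  exact (variance_le_expectation_sq (hX i).aestronglyMeasurable).trans (hV i)

end Rows

/-! ### Explicit gradients of the network and the recursion for their Gram matrices. -/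

section Network

variable {d m L : ℕ}

/-- The index of the weight from unit `j` of layer `l` to unit `i` of layer `l + 1`. -/
def weightIdx {l : ℕ} (h : l < L) (i : Fin m) (j : Fin (layerWidth d m l)) : ParamIdx d m L :=
  Sum.inl ⟨⟨l, h⟩, i, j⟩

lemma weightIdx_injective2 {l : ℕ} (h : l < L) :
    Function.Injective2 (weightIdx (d := d) (m := m) h) := by
  intro i j a b hab
  simp only [weightIdx, Sum.inl.injEq, Sigma.mk.injEq, heq_eq_eq, true_and] at hab
  exact Prod.mk.inj hab

lemma weightIdx_eq_iff {l : ℕ} (h : l < L) (i k : Fin m) (j j' : Fin (layerWidth d m l)) :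
    weightIdx h i j = weightIdx h k j' ↔ i = k ∧ j = j' :=
  ⟨fun e => weightIdx_injective2 h e, fun ⟨e, e'⟩ => by rw [e, e']⟩

variable (σ D : ℝ → ℝ) (c : ℝ) (w : Params d m L) (x z : EuclideanSpace ℝ (Fin d))

/-- The input of unit `i` of layer `l + 1` before the activation. -/
def preactivation {l : ℕ} (h : l < L) (i : Fin m) : ℝ :=
  ∑ j, w (weightIdx h i j) * embedding σ c w x l j

lemma embedding_succ {l : ℕ} (h : l < L) (i : Fin m) :
    embedding σ c w x (l + 1) i = c / √(m : ℝ) * σ (preactivation σ c w x h i) := by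
  simp only [embedding, h, dif_pos]
  rfl

/-- The gradient of unit `i` of layer `l` with respect to all parameters, where `D` is the
derivative of the activation. -/
def embeddingGrad : (l : ℕ) → Fin (layerWidth d m l) → Params d m L
  | 0, _ => 0
  | l + 1, i =>
      if h : l < L then
        (c / √(m : ℝ) * D (preactivation σ c w x h i)) •
          ∑ j, (w (weightIdx h i j) • embeddingGrad l j +
            embedding σ c w x l j • EuclideanSpace.single (weightIdx (m := m) h i j) (1 : ℝ))
      else 0

/-- The gradient of the output with respect to all parameters. -/
def networkGrad : Params d m L :=
  ∑ j, (w (Sum.inr j) • embeddingGrad σ D c w x L j +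
    embedding σ c w x L j • EuclideanSpace.single (Sum.inr j) (1 : ℝ))

lemma embeddingGrad_succ {l : ℕ} (h : l < L) (i : Fin m) :
    embeddingGrad σ D c w x (l + 1) i = (c / √(m : ℝ) * D (preactivation σ c w x h i)) •
      ∑ j, (w (weightIdx h i j) • embeddingGrad σ D c w x l j +
        embedding σ c w x l j • EuclideanSpace.single (weightIdx (m := m) h i j) (1 : ℝ)) := by
  simp only [embeddingGrad, h, dif_pos]

variable {σ D}

/-- The product rule, common to preactivations and output: a weight acts once as a coefficient of an
older gradient and once as a parameter. -/
lemma hasFDerivAt_weighted_sum {n : ℕ} {f : Params d m L → Fin n → ℝ} {g : Fin n → Params d m L}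
    (p : Fin n → ParamIdx d m L)
    (hf : ∀ j, HasFDerivAt (fun v => f v j) (innerSL ℝ (g j)) w) :
    HasFDerivAt (fun v : Params d m L => ∑ j, v (p j) * f v j)
      (innerSL ℝ (∑ j, (w (p j) • g j + f w j • EuclideanSpace.single (p j) (1 : ℝ)))) w := by
  have h1 : ∀ j, HasFDerivAt (fun v : Params d m L => v (p j))
      (innerSL ℝ (EuclideanSpace.single (p j) (1 : ℝ))) w := by
    intro j
    have h2 := (EuclideanSpace.proj (𝕜 := ℝ) (p j) : Params d m L →L[ℝ] ℝ).hasFDerivAt (x := w)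
    convert! h2 using 1
    ext v
    rw [innerSL_apply_apply]
    simp [EuclideanSpace.inner_single_left]
  have h3 := HasFDerivAt.fun_sum (u := Finset.univ) fun j _ => (h1 j).mul (hf j)
  convert! h3 using 1
  simp [map_sum, map_add, map_smul]

lemma hasFDerivAt_embedding (hσ : ∀ t, t ≠ 0 → HasDerivAt σ (D t) t)
    (hw : ∀ l (h : l < L) i, preactivation σ c w x h i ≠ 0) :
    ∀ l, l ≤ L → ∀ i, HasFDerivAt (fun v : Params d m L => embedding σ c v x l i)
      (innerSL ℝ (embeddingGrad σ D c w x l i)) w := by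
  intro l
  induction l with
  | zero =>
    intro _ i
    simp only [embedding, embeddingGrad, map_zero]
    exact hasFDerivAt_const _ _
  | succ l ih =>
    intro hl i
    have h : l < L := hl
    have h1 := hasFDerivAt_weighted_sum w (weightIdx h i) (fun j => ih h.le j)
    have h2 := ((hσ _ (hw l h i)).comp_hasFDerivAt w h1).const_mul (c / √(m : ℝ))
    rw [embeddingGrad_succ σ D c w x h i]
    convert! h2 using 1
    · ext v
      exact embedding_succ σ c v x h i
    · rw [map_smul, smul_smul]

/-- Away from the kinks the formal gradient, built by the chain rule from `D`, is the true one. -/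
lemma modelGradient_eq (hσ : ∀ t, t ≠ 0 → HasDerivAt σ (D t) t)
    (hw : ∀ l (h : l < L) i, preactivation σ c w x h i ≠ 0) :
    modelGradient σ c w x = networkGrad σ D c w x := by
  have h1 := hasFDerivAt_weighted_sum w (fun j => Sum.inr j)
    (fun j => hasFDerivAt_embedding c w x hσ hw L le_rfl j)
  refine HasGradientAt.gradient ?_
  rw [hasGradientAt_iff_hasFDerivAt]
  convert! h1 using 1

variable (σ D)

/-- Layer `l` depends only on the weights below it. This makes the directions of newer weights
orthogonal to all older gradients. -/
lemma embeddingGrad_apply_eq_zero (p : ParamIdx d m L) :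
    ∀ l, (∀ l' (h' : l' < L) i j, l' < l → p ≠ weightIdx h' i j) →
      ∀ i, embeddingGrad σ D c w x l i p = 0 := by
  intro l
  induction l with
  | zero => intro _ i; simp [embeddingGrad]
  | succ l ih =>
    intro hp i
    by_cases h : l < L
    · have h1 := ih fun l' h' i j hl => hp l' h' i j (by omega)
      rw [embeddingGrad_succ σ D c w x h i, PiLp.smul_apply]
      have h2 : (∑ j, (w (weightIdx h i j) • embeddingGrad σ D c w x l j +
        embedding σ c w x l j • EuclideanSpace.single (weightIdx (m := m) h i j) (1 : ℝ))) p = 0 := by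
        rw [WithLp.ofLp_sum, Finset.sum_apply]
        refine Finset.sum_eq_zero fun j _ => ?_
        simp [h1 j, hp l h i j (by omega)]
      rw [h2, smul_zero]
    · simp [embeddingGrad, h]

lemma inner_embeddingGrad_single (l : ℕ) (i : Fin (layerWidth d m l)) (p : ParamIdx d m L)
    (hp : ∀ l' (h' : l' < L) i j, l' < l → p ≠ weightIdx h' i j) :
    inner ℝ (embeddingGrad σ D c w x l i) (EuclideanSpace.single p (1 : ℝ)) = 0 := by
  rw [EuclideanSpace.inner_single_right, embeddingGrad_apply_eq_zero σ D c w x p l hp]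
  simp

/-- The Gram matrix of the gradients of the units of layer `l` at two inputs. -/
def gradGram (l : ℕ) (i k : Fin (layerWidth d m l)) : ℝ :=
  inner ℝ (embeddingGrad σ D c w x l i) (embeddingGrad σ D c w z l k)

/-- The Gram entry of the embeddings of two inputs at layer `l`. -/
def embeddingGram (l : ℕ) : ℝ :=
  inner ℝ (embedding σ c w x l) (embedding σ c w z l)

lemma embeddingGram_eq_sum (l : ℕ) :
    embeddingGram σ c w x z l = ∑ j, embedding σ c w x l j * embedding σ c w z l j := by
  simp [embeddingGram, PiLp.inner_apply, mul_comm]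

lemma inner_weighted_sum {n : ℕ} (g g' : Fin n → Params d m L) (u v α β : Fin n → ℝ)
    (p q : Fin n → ParamIdx d m L)
    (hg : ∀ a b, inner ℝ (g a) (EuclideanSpace.single (q b) (1 : ℝ)) = 0)
    (hg' : ∀ a b, inner ℝ (g' a) (EuclideanSpace.single (p b) (1 : ℝ)) = 0) :
    inner ℝ (∑ a, (u a • g a + α a • EuclideanSpace.single (p a) (1 : ℝ)))
      (∑ b, (v b • g' b + β b • EuclideanSpace.single (q b) (1 : ℝ))) =
      ∑ a, ∑ b, inner ℝ (g a) (g' b) * (u a * v b) +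
        ∑ a, ∑ b, if p a = q b then α a * β b else 0 := by
  have hg2 : ∀ a b, inner ℝ (EuclideanSpace.single (p b) (1 : ℝ)) (g' a) = 0 := fun a b => by
    rw [real_inner_comm, hg']
  rw [sum_inner, ← Finset.sum_add_distrib]
  refine Finset.sum_congr rfl fun a _ => ?_
  rw [inner_sum, ← Finset.sum_add_distrib]
  refine Finset.sum_congr rfl fun b _ => ?_
  rw [inner_add_left, inner_add_right, inner_add_right]
  simp only [real_inner_smul_left, real_inner_smul_right, hg, hg2,
    EuclideanSpace.inner_single_left]
  by_cases h : p a = q b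
  · simp [h]; ring
  · simp [h]; ring

/-- Cross terms between older gradients and new weight directions vanish by locality. The new
directions contribute only on the diagonal, since distinct units share no incoming weight. -/
lemma gradGram_succ {l : ℕ} (h : l < L) (i k : Fin m) :
    gradGram σ D c w x z (l + 1) i k =
      (c / √(m : ℝ)) ^ 2 * (D (preactivation σ c w x h i) * D (preactivation σ c w z h k)) *
      (∑ a, ∑ b, gradGram σ D c w x z l a b * (w (weightIdx h i a) * w (weightIdx h k b)) +
        if i = k then embeddingGram σ c w x z l else 0) := by
  have hne : ∀ (i : Fin m) (j : Fin (layerWidth d m l)) l' (h' : l' < L) i' j', l' < l →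
      weightIdx h i j ≠ weightIdx h' i' j' := by
    intro i j l' h' i' j' hl heq
    simp only [weightIdx, Sum.inl.injEq, Sigma.mk.injEq, Fin.mk.injEq] at heq
    omega
  change inner ℝ (embeddingGrad σ D c w x (l + 1) i) (embeddingGrad σ D c w z (l + 1) k) = _
  rw [embeddingGrad_succ σ D c w x h i, embeddingGrad_succ σ D c w z h k,
    real_inner_smul_left, real_inner_smul_right, inner_weighted_sum]
  · simp only [weightIdx_eq_iff, gradGram]
    have h1 : (∑ a, ∑ b, if i = k ∧ a = b then embedding σ c w x l a * embedding σ c w z l b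
        else 0) = if i = k then embeddingGram σ c w x z l else 0 := by
      by_cases hik : i = k
      · simp [hik, embeddingGram_eq_sum]
      · simp [hik]
    rw [h1]
    ring
  · exact fun a b => inner_embeddingGrad_single σ D c w x l a _ (hne k b)
  · exact fun a b => inner_embeddingGrad_single σ D c w z l a _ (hne i b)

lemma inner_networkGrad :
    inner ℝ (networkGrad σ D c w x) (networkGrad σ D c w z) =
      ∑ a, ∑ b, gradGram σ D c w x z L a b * (w (Sum.inr a) * w (Sum.inr b)) +
        embeddingGram σ c w x z L := by
  rw [networkGrad, networkGrad, inner_weighted_sum]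
  · simp [gradGram, embeddingGram_eq_sum]
  · exact fun a b => inner_embeddingGrad_single σ D c w x L a _ (by simp [weightIdx])
  · exact fun a b => inner_embeddingGrad_single σ D c w z L a _ (by simp [weightIdx])

section Locality

variable {w} {w' : Params d m L}

lemma embedding_congr : ∀ l,
    (∀ l' (h : l' < L), l' < l → ∀ i j, w (weightIdx h i j) = w' (weightIdx h i j)) →
      embedding σ c w x l = embedding σ c w' x l := by
  intro l
  induction l with
  | zero => intro _; rfl
  | succ l ih =>
    intro hw
    have h1 := ih fun l' h hl => hw l' h (by omega)
    by_cases h : l < L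
    · ext i
      rw [embedding_succ σ c w x h i, embedding_succ σ c w' x h i]
      have h3 : ∀ j, w (weightIdx (m := m) h i j) = w' (weightIdx (m := m) h i j) :=
        hw l h (by omega) i
      simp only [preactivation, h1, h3]
    · simp [embedding, h]

lemma embeddingGrad_congr : ∀ l,
    (∀ l' (h : l' < L), l' < l → ∀ i j, w (weightIdx h i j) = w' (weightIdx h i j)) →
      embeddingGrad σ D c w x l = embeddingGrad σ D c w' x l := by
  intro l
  induction l with
  | zero => intro _; rfl
  | succ l ih =>
    intro hw
    have h1 := ih fun l' h hl => hw l' h (by omega)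
    have h2 := embedding_congr σ c x l fun l' h hl => hw l' h (by omega)
    ext i : 1
    by_cases h : l < L
    · rw [embeddingGrad_succ σ D c w x h i, embeddingGrad_succ σ D c w' x h i]
      have h3 : ∀ j, w (weightIdx (m := m) h i j) = w' (weightIdx (m := m) h i j) :=
        hw l h (by omega) i
      simp only [preactivation, h1, h2, h3]
    · simp [embeddingGrad, h]

end Locality

section Measurability

variable {σ D}

lemma measurable_embedding (hσ : Measurable σ) : ∀ l i,
    Measurable fun v : ParamIdx d m L → ℝ => embedding σ c (WithLp.toLp 2 v) x l i := by
  intro l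
  induction l with
  | zero =>
    intro i
    simp only [embedding]
    exact measurable_const
  | succ l ih =>
    intro i
    by_cases h : l < L
    · rw [show (fun v : ParamIdx d m L → ℝ => embedding σ c (WithLp.toLp 2 v) x (l + 1) i) =
        fun v => c / √(m : ℝ) * σ (preactivation σ c (WithLp.toLp 2 v) x h i) from
        funext fun v => embedding_succ σ c _ x h i]
      simp only [preactivation]
      refine measurable_const.mul (hσ.comp (Finset.measurable_sum _ fun j _ => ?_))
      exact (measurable_pi_apply _).mul (ih j)
    · simp [embedding, h]

lemma measurable_preactivation (hσ : Measurable σ) {l : ℕ} (h : l < L) (i : Fin m) :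
    Measurable fun v : ParamIdx d m L → ℝ => preactivation σ c (WithLp.toLp 2 v) x h i := by
  simp only [preactivation]
  exact Finset.measurable_sum _ fun j _ =>
    (measurable_pi_apply _).mul (measurable_embedding c x hσ l j)

lemma measurable_embeddingGram (hσ : Measurable σ) (l : ℕ) :
    Measurable fun v : ParamIdx d m L → ℝ => embeddingGram σ c (WithLp.toLp 2 v) x z l := by
  simp only [embeddingGram_eq_sum]
  exact Finset.measurable_sum _ fun j _ =>
    (measurable_embedding c x hσ l j).mul (measurable_embedding c z hσ l j)

lemma measurable_gradGram (hσ : Measurable σ) (hD : Measurable D) : ∀ l i k,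
    Measurable fun v : ParamIdx d m L → ℝ => gradGram σ D c (WithLp.toLp 2 v) x z l i k := by
  intro l
  induction l with
  | zero => intro i k; simp [gradGram, embeddingGrad]
  | succ l ih =>
    intro i k
    by_cases h : l < L
    · rw [funext fun v : ParamIdx d m L → ℝ => gradGram_succ σ D c (WithLp.toLp 2 v) x z h i k]
      refine (measurable_const.mul ((hD.comp (measurable_preactivation c x hσ h i)).mul
        (hD.comp (measurable_preactivation c z hσ h k)))).mul (Measurable.add ?_ ?_)
      · refine Finset.measurable_sum _ fun a _ => Finset.measurable_sum _ fun b _ => ?_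
        exact (ih a b).mul ((measurable_pi_apply _).mul (measurable_pi_apply _))
      · exact Measurable.ite (MeasurableSet.const _) (measurable_embeddingGram c x z hσ l)
          measurable_const
    · simp [gradGram, embeddingGrad, h]

end Measurability

end Network

/-! ### Common setting for the two activations, and the initialization filter. -/

/-- An activation `σ` with derivative `D` and scaling `c`, whose normalized Gaussian covariance
kernels are given by the functions `k₁` (for `σ`) and `k₀` (for `D`) of the cosine of the angle. -/
structure HasGaussianKernels (σ D : ℝ → ℝ) (c : ℝ) (k₁ k₀ : ℝ → ℝ) : Prop where
  measurable_act : Measurable σ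
  measurable_deriv : Measurable D
  abs_act_le : ∀ t, |σ t| ≤ |t|
  abs_deriv_le : ∀ t, |D t| ≤ 1
  hasDerivAt : ∀ t, t ≠ 0 → HasDerivAt σ (D t) t
  continuous_one : Continuous k₁
  continuous_zero : Continuous k₀
  one_eq : k₁ 1 = 1
  zero_eq : k₀ 1 = 1
  integral_act : ∀ (n : ℕ) (a b : EuclideanSpace ℝ (Fin n)), a ≠ 0 → b ≠ 0 →
    c ^ 2 * ∫ w, σ (∑ j, w j * a j) * σ (∑ j, w j * b j)
      ∂(Measure.pi fun _ : Fin n => gaussianReal 0 1) = ‖a‖ * ‖b‖ * k₁ (cos (angle a b))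
  integral_deriv : ∀ (n : ℕ) (a b : EuclideanSpace ℝ (Fin n)), a ≠ 0 → b ≠ 0 →
    c ^ 2 * ∫ w, D (∑ j, w j * a j) * D (∑ j, w j * b j)
      ∂(Measure.pi fun _ : Fin n => gaussianReal 0 1) = k₀ (cos (angle a b))

/-- Events of asymptotically full probability at initialization, as the width tends to infinity. -/
def initFilter (d L : ℕ) : Filter (Σ m, (ParamIdx d m L → ℝ)) :=
  whp fun m => Measure.pi fun _ : ParamIdx d m L => gaussianReal 0 1

/-- The parameters `w` with the block `s` of coordinates replaced by those of `w'`. -/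
def resample {ι : Type*} (s : Set ι) (w' w : ι → ℝ) : ι → ℝ :=
  @Set.piecewise ι (fun _ => ℝ) s w' w (fun _ => Classical.propDecidable _)

section

variable {ι : Type*} {s : Set ι} {w' w : ι → ℝ}

lemma resample_of_mem {i : ι} (hi : i ∈ s) : resample s w' w i = w' i := by
  classical
  simp [resample, hi]

lemma resample_of_notMem {i : ι} (hi : i ∉ s) : resample s w' w i = w i := by
  classical
  simp [resample, hi]

end

variable {d L : ℕ}

lemma tendsto_initFilter_zero (s : ∀ m, Set (ParamIdx d m L))
    (Y : ∀ m, (ParamIdx d m L → ℝ) → ℝ)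
    (hY : ∀ m, Measurable (Y m)) (hY0 : ∀ m w, 0 ≤ Y m w) (B : (Σ m, (ParamIdx d m L → ℝ)) → ℝ)
    (hB : Tendsto B (initFilter d L) (𝓝 0))
    (h : ∀ᶠ x in initFilter d L,
      Integrable (fun w' => Y x.1 (resample (s x.1) w' x.2))
        (Measure.pi fun _ : ParamIdx d x.1 L => gaussianReal 0 1) ∧
      ∫ w', Y x.1 (resample (s x.1) w' x.2)
        ∂(Measure.pi fun _ : ParamIdx d x.1 L => gaussianReal 0 1) ≤ B x) :
    Tendsto (fun x => Y x.1 x.2) (initFilter d L) (𝓝 0) :=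
  tendsto_whp_zero_of_piecewise (ν := fun _ _ => gaussianReal 0 1) s Y hY hY0 B hB h

lemma tendsto_initFilter_zero_sq (s : ∀ m, Set (ParamIdx d m L))
    (Y : ∀ m, (ParamIdx d m L → ℝ) → ℝ)
    (hY : ∀ m, Measurable (Y m)) (B : (Σ m, (ParamIdx d m L → ℝ)) → ℝ)
    (hB : Tendsto B (initFilter d L) (𝓝 0))
    (h : ∀ᶠ x in initFilter d L,
      Integrable (fun w' => Y x.1 (resample (s x.1) w' x.2) ^ 2)
        (Measure.pi fun _ : ParamIdx d x.1 L => gaussianReal 0 1) ∧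
      ∫ w', Y x.1 (resample (s x.1) w' x.2) ^ 2
        ∂(Measure.pi fun _ : ParamIdx d x.1 L => gaussianReal 0 1) ≤ B x) :
    Tendsto (fun x => Y x.1 x.2) (initFilter d L) (𝓝 0) :=
  tendsto_whp_zero_of_piecewise_sq (ν := fun _ _ => gaussianReal 0 1) s Y hY B hB h

lemma tendsto_width_inv : Tendsto (fun x : Σ m, (ParamIdx d m L → ℝ) => ((x.1 : ℝ))⁻¹)
    (initFilter d L) (𝓝 0) :=
  tendsto_inv_atTop_zero.comp (tendsto_natCast_atTop_atTop.comp tendsto_fst_whp)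

lemma eventually_width_pos : ∀ᶠ x in initFilter d L, 0 < x.1 :=
  tendsto_fst_whp.eventually (eventually_gt_atTop 0)

/-- The parameters of the connections from layer `l` to layer `l + 1`. -/
def layerBlock {l : ℕ} (h : l < L) (m : ℕ) : Set (ParamIdx d m L) :=
  {p | ∃ (i : Fin m) (j : Fin (layerWidth d m l)), p = weightIdx h i j}

/-- The parameters of the output layer. -/
def outputBlock (m : ℕ) : Set (ParamIdx d m L) := {p | ∃ j, p = Sum.inr j}

/-! ### Resampling one layer leaves everything below it unchanged. -/

section Resample

variable {m : ℕ} (σ D : ℝ → ℝ) (c : ℝ) (w' w : ParamIdx d m L → ℝ) (x z : EuclideanSpace ℝ (Fin d))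

lemma resample_weightIdx {l : ℕ} (h : l < L) (i : Fin m) (j : Fin (layerWidth d m l)) :
    resample (layerBlock h m) w' w (weightIdx h i j) = w' (weightIdx h i j) :=
  resample_of_mem ⟨i, j, rfl⟩

lemma resample_weightIdx_of_lt {l l' : ℕ} (h : l < L) (h' : l' < L) (hl : l' < l) (i : Fin m)
    (j : Fin (layerWidth d m l')) :
    (WithLp.toLp 2 (resample (layerBlock h m) w' w) : Params d m L) (weightIdx h' i j) =
      (WithLp.toLp 2 w : Params d m L) (weightIdx h' i j) := by
  refine resample_of_notMem ?_
  rintro ⟨i', j', heq⟩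
  simp only [weightIdx, Sum.inl.injEq, Sigma.mk.injEq, Fin.mk.injEq] at heq
  omega

lemma embedding_resample {l : ℕ} (h : l < L) :
    embedding σ c (WithLp.toLp 2 (resample (layerBlock h m) w' w) : Params d m L) x l =
      embedding σ c (WithLp.toLp 2 w : Params d m L) x l :=
  embedding_congr σ c x l fun _ h' hl i j => resample_weightIdx_of_lt w' w h h' hl i j

lemma embeddingGrad_resample {l : ℕ} (h : l < L) :
    embeddingGrad σ D c (WithLp.toLp 2 (resample (layerBlock h m) w' w) : Params d m L) x l =
      embeddingGrad σ D c (WithLp.toLp 2 w : Params d m L) x l :=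
  embeddingGrad_congr σ D c x l fun _ h' hl i j => resample_weightIdx_of_lt w' w h h' hl i j

lemma embeddingGram_resample {l : ℕ} (h : l < L) :
    embeddingGram σ c (WithLp.toLp 2 (resample (layerBlock h m) w' w) : Params d m L) x z l =
      embeddingGram σ c (WithLp.toLp 2 w : Params d m L) x z l := by
  simp only [embeddingGram, embedding_resample]

lemma gradGram_resample {l : ℕ} (h : l < L) :
    gradGram σ D c (WithLp.toLp 2 (resample (layerBlock h m) w' w) : Params d m L) x z l =
      gradGram σ D c (WithLp.toLp 2 w : Params d m L) x z l := by
  ext i k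
  simp only [gradGram, embeddingGrad_resample]

lemma preactivation_resample {l : ℕ} (h : l < L) (i : Fin m) :
    preactivation σ c (WithLp.toLp 2 (resample (layerBlock h m) w' w) : Params d m L) x h i =
      ∑ j, w' (weightIdx h i j) * embedding σ c (WithLp.toLp 2 w : Params d m L) x l j := by
  simp only [preactivation, embedding_resample, resample_weightIdx]

lemma gradGram_resample_output :
    gradGram σ D c (WithLp.toLp 2 (resample (outputBlock m) w' w) : Params d m L) x z L =
      gradGram σ D c (WithLp.toLp 2 w : Params d m L) x z L := by
  have h : ∀ l' (h : l' < L), l' < L → ∀ (i : Fin m) (j : Fin (layerWidth d m l')),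
      (WithLp.toLp 2 (resample (outputBlock m) w' w) : Params d m L) (weightIdx h i j) =
        (WithLp.toLp 2 w : Params d m L) (weightIdx h i j) := by
    intro l' h' _ i j
    refine resample_of_notMem ?_
    rintro ⟨j', heq⟩
    simp [weightIdx] at heq
  ext i k
  simp only [gradGram, embeddingGrad_congr σ D c _ L h]

end Resample

section Row

variable {ι κ : Type*} {n : ℕ} {e : κ → Fin n → ι}

lemma row_mul_row (e : κ → Fin n → ι) (i : κ) (a b : Fin n → ℝ) (w : ι → ℝ) :
    (∑ j, w (e i j) * a j) * (∑ j, w (e i j) * b j) =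
      blockForm (fun j k => a j * b k) (e i) (e i) w := by
  simp only [blockForm, Finset.sum_mul_sum]
  refine Finset.sum_congr rfl fun j _ => Finset.sum_congr rfl fun k _ => by ring

variable [Fintype ι]

lemma integral_row_mul_row_sq_le (he : Function.Injective2 e) (i : κ)
    (a b : EuclideanSpace ℝ (Fin n)) :
    ∫ w, ((∑ j, w (e i j) * a j) * (∑ j, w (e i j) * b j)) ^ 2
      ∂(Measure.pi fun _ : ι => gaussianReal 0 1) ≤ 3 * (‖a‖ ^ 2 * ‖b‖ ^ 2) := by
  simp only [row_mul_row]
  refine (integral_blockForm_sq_self_le he _ i).trans ?_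
  have h1 : ∑ j, ∑ k, (a j * b k) ^ 2 = ‖a‖ ^ 2 * ‖b‖ ^ 2 := by
    simp only [EuclideanSpace.real_norm_sq_eq, Finset.sum_mul_sum, mul_pow]
  have h2 : (∑ j, a j * b j) ^ 2 ≤ ‖a‖ ^ 2 * ‖b‖ ^ 2 := by
    simp only [EuclideanSpace.real_norm_sq_eq]
    exact Finset.sum_mul_sq_le_sq_mul_sq _ _ _
  linarith

/-- The growth condition `hb` covers both the activation and its derivative. With `(1 + |s|)² ≤ 2 +
2 s²` and the fourth-moment bound, each row has second moment at most `2 + 6 ‖a‖² ‖b‖²`. For `t = c²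
/ m` and `m` rows the total is of order `1 / m`. -/
lemma integral_row_stat [Fintype κ] {ψ : ℝ → ℝ} (hψ : Measurable ψ)
    (hb : ∀ s t, |ψ s * ψ t| ≤ 1 + |s * t|) (he : Function.Injective2 e)
    (a b : EuclideanSpace ℝ (Fin n)) (t : ℝ) :
    Integrable (fun w => (t * ∑ i, (ψ (∑ j, w (e i j) * a j) * ψ (∑ j, w (e i j) * b j) -
      ∫ w, ψ (∑ j, w j * a j) * ψ (∑ j, w j * b j)
        ∂(Measure.pi fun _ : Fin n => gaussianReal 0 1))) ^ 2)
      (Measure.pi fun _ : ι => gaussianReal 0 1) ∧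
    ∫ w, (t * ∑ i, (ψ (∑ j, w (e i j) * a j) * ψ (∑ j, w (e i j) * b j) -
      ∫ w, ψ (∑ j, w j * a j) * ψ (∑ j, w j * b j)
        ∂(Measure.pi fun _ : Fin n => gaussianReal 0 1))) ^ 2
      ∂(Measure.pi fun _ : ι => gaussianReal 0 1) ≤
      t ^ 2 * (Fintype.card κ * (2 + 6 * (‖a‖ ^ 2 * ‖b‖ ^ 2))) := by
  set f : (Fin n → ℝ) → ℝ := fun w => ψ (∑ j, w j * a j) * ψ (∑ j, w j * b j) with hf
  have hfm : Measurable f := by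
    refine (hψ.comp ?_).mul (hψ.comp ?_) <;> fun_prop
  have hXm : ∀ i : κ, Measurable fun w : ι → ℝ => f fun j => w (e i j) :=
    fun i => hfm.comp (by fun_prop)
  have hle : ∀ (i : κ) (w : ι → ℝ), (f fun j => w (e i j)) ^ 2 ≤
      2 + 2 * ((∑ j, w (e i j) * a j) * (∑ j, w (e i j) * b j)) ^ 2 := by
    intro i w
    have h1 := hb (∑ j, w (e i j) * a j) (∑ j, w (e i j) * b j)
    have h2 := pow_le_pow_left₀ (abs_nonneg _) h1 2
    rw [sq_abs] at h2
    refine h2.trans ?_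
    nlinarith [sq_nonneg (1 - |(∑ j, w (e i j) * a j) * (∑ j, w (e i j) * b j)|),
      sq_abs ((∑ j, w (e i j) * a j) * (∑ j, w (e i j) * b j))]
  have hdom : ∀ i : κ, Integrable (fun w : ι → ℝ =>
      2 + 2 * ((∑ j, w (e i j) * a j) * (∑ j, w (e i j) * b j)) ^ 2)
      (Measure.pi fun _ : ι => gaussianReal 0 1) := by
    intro i
    simp only [row_mul_row]
    exact (integrable_const _).add ((integrable_blockForm_sq _ _ _).const_mul _)
  have hint : ∀ i : κ, Integrable (fun w : ι → ℝ => (f fun j => w (e i j)) ^ 2)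
      (Measure.pi fun _ : ι => gaussianReal 0 1) := by
    intro i
    refine (hdom i).mono ((hXm i).pow_const 2).aestronglyMeasurable (ae_of_all _ fun w => ?_)
    rw [Real.norm_eq_abs, Real.norm_eq_abs, abs_of_nonneg (sq_nonneg _), abs_of_nonneg]
    · exact hle i w
    · positivity
  refine integral_sum_sub_sq_le (fun i (w : ι → ℝ) => f fun j => w (e i j)) _ _ t
    (fun i => ?_) (fun i => ?_) (fun i => ?_) (fun i j hij => ?_)
  · exact (memLp_two_iff_integrable_sq (hXm i).aestronglyMeasurable).2 (hint i)
  · have hp := measurePreserving_block (gaussianReal 0 1) he i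
    rw [← hp.map_eq, integral_map hp.measurable.aemeasurable hfm.aestronglyMeasurable]
  · refine (integral_mono (hint i) (hdom i) (hle i)).trans ?_
    rw [integral_add (integrable_const _), integral_const_mul]
    · have := integral_row_mul_row_sq_le he i a b
      simp only [integral_const, probReal_univ, one_smul]
      linarith
    · simp only [row_mul_row]
      exact (integrable_blockForm_sq _ _ _).const_mul _
  · exact indepFun_blocks (fun _ => gaussianReal 0 1) he hij hfm hfm

end Row

/-! ### One layer of the induction: concentration of averages, traces and Frobenius norms. -/

section Steps

variable {σ D : ℝ → ℝ} {c : ℝ} {k₁ k₀ : ℝ → ℝ} {d L : ℕ} (x z : EuclideanSpace ℝ (Fin d))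

/-- The random Gram entry of the embeddings at layer `l`. -/
def randGram (σ : ℝ → ℝ) (c : ℝ) (x z : EuclideanSpace ℝ (Fin d)) (l : ℕ)
    (X : Σ m, (ParamIdx d m L → ℝ)) : ℝ :=
  embeddingGram σ c (WithLp.toLp 2 X.2 : Params d X.1 L) x z l

/-- The trace of the random Gram matrix of the gradients of the units of layer `l`. -/
def randTrace (σ D : ℝ → ℝ) (c : ℝ) (x z : EuclideanSpace ℝ (Fin d)) (l : ℕ)
    (X : Σ m, (ParamIdx d m L → ℝ)) : ℝ :=
  ∑ a, gradGram σ D c (WithLp.toLp 2 X.2 : Params d X.1 L) x z l a a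

/-- The squared Frobenius norm of the random Gram matrix of the gradients of layer `l`. -/
def randFrob (σ D : ℝ → ℝ) (c : ℝ) (x z : EuclideanSpace ℝ (Fin d)) (l : ℕ)
    (X : Σ m, (ParamIdx d m L → ℝ)) : ℝ :=
  ∑ a, ∑ b, gradGram σ D c (WithLp.toLp 2 X.2 : Params d X.1 L) x z l a b ^ 2

/-- The average over the units of layer `l + 1` of a product of functions of the inputs of the
units, normalized as in the network. -/
def randAverage (σ : ℝ → ℝ) (c : ℝ) (ψ : ℝ → ℝ) (x z : EuclideanSpace ℝ (Fin d)) {l : ℕ}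
    (h : l < L) (X : Σ m, (ParamIdx d m L → ℝ)) : ℝ :=
  c ^ 2 / X.1 * ∑ i : Fin X.1, ψ (preactivation σ c (WithLp.toLp 2 X.2 : Params d X.1 L) x h i) *
    ψ (preactivation σ c (WithLp.toLp 2 X.2 : Params d X.1 L) z h i)

lemma measurable_randGram (hσ : Measurable σ) (l m : ℕ) :
    Measurable fun w => randGram (L := L) σ c x z l ⟨m, w⟩ :=
  measurable_embeddingGram c x z hσ l

lemma measurable_randTrace (hσ : Measurable σ) (hD : Measurable D) (l m : ℕ) :
    Measurable fun w => randTrace (L := L) σ D c x z l ⟨m, w⟩ := by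
  change Measurable fun w : ParamIdx d m L → ℝ => ∑ a : Fin (layerWidth d m l),
    gradGram σ D c (WithLp.toLp 2 w : Params d m L) x z l a a
  exact Finset.measurable_sum _ fun a _ => measurable_gradGram c x z hσ hD l a a

lemma measurable_randFrob (hσ : Measurable σ) (hD : Measurable D) (l m : ℕ) :
    Measurable fun w => randFrob (L := L) σ D c x z l ⟨m, w⟩ := by
  change Measurable fun w : ParamIdx d m L → ℝ => ∑ a : Fin (layerWidth d m l),
    ∑ b : Fin (layerWidth d m l), gradGram σ D c (WithLp.toLp 2 w : Params d m L) x z l a b ^ 2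
  exact Finset.measurable_sum _ fun a _ => Finset.measurable_sum _ fun b _ =>
    (measurable_gradGram c x z hσ hD l a b).pow_const 2

lemma measurable_randAverage (hσ : Measurable σ) {ψ : ℝ → ℝ} (hψ : Measurable ψ) {l : ℕ}
    (h : l < L) (m : ℕ) : Measurable fun w => randAverage σ c ψ x z h ⟨m, w⟩ := by
  change Measurable fun w : ParamIdx d m L → ℝ => c ^ 2 / m * ∑ i : Fin m,
    ψ (preactivation σ c (WithLp.toLp 2 w : Params d m L) x h i) *
      ψ (preactivation σ c (WithLp.toLp 2 w : Params d m L) z h i)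
  refine measurable_const.mul (Finset.measurable_sum _ fun i _ => ?_)
  exact (hψ.comp (measurable_preactivation c x hσ h i)).mul
    (hψ.comp (measurable_preactivation c z hσ h i))

lemma eventually_embedding_ne_zero {l : ℕ} {p : ℝ} (hp : 0 < p)
    (hx : Tendsto (randGram σ c x x l) (initFilter d L) (𝓝 p)) :
    ∀ᶠ X in initFilter d L, embedding σ c (WithLp.toLp 2 X.2 : Params d X.1 L) x l ≠ 0 := by
  filter_upwards [hx.eventually (lt_mem_nhds hp)] with X hX h0
  simp [randGram, embeddingGram, h0] at hX

/-- Concentration of an average over the units of a layer, around a continuous function of the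
Gram matrix of the previous layer. -/
lemma tendsto_randAverage (hσ : Measurable σ) {ψ : ℝ → ℝ} (hψ : Measurable ψ)
    (hb : ∀ s t, |ψ s * ψ t| ≤ 1 + |s * t|) {K : ℝ → ℝ → ℝ → ℝ}
    (hK : Measurable fun p : ℝ × ℝ × ℝ => K p.1 p.2.1 p.2.2)
    (hint : ∀ (n : ℕ) (a b : EuclideanSpace ℝ (Fin n)), a ≠ 0 → b ≠ 0 →
      c ^ 2 * ∫ w, ψ (∑ j, w j * a j) * ψ (∑ j, w j * b j)
        ∂(Measure.pi fun _ : Fin n => gaussianReal 0 1) =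
        K (inner ℝ a a) (inner ℝ b b) (inner ℝ a b))
    {l : ℕ} (h : l < L) {p q r : ℝ} (hp : 0 < p) (hq : 0 < q)
    (hx : Tendsto (randGram σ c x x l) (initFilter d L) (𝓝 p))
    (hz : Tendsto (randGram σ c z z l) (initFilter d L) (𝓝 q))
    (hxz : Tendsto (randGram σ c x z l) (initFilter d L) (𝓝 r))
    (hKc : ContinuousAt (fun p : ℝ × ℝ × ℝ => K p.1 p.2.1 p.2.2) (p, q, r)) :
    Tendsto (randAverage σ c ψ x z h) (initFilter d L) (𝓝 (K p q r)) := by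
  have h1 : Tendsto (fun X => K (randGram σ c x x l X) (randGram σ c z z l X)
      (randGram σ c x z l X)) (initFilter d L) (𝓝 (K p q r)) :=
    hKc.tendsto.comp (hx.prodMk_nhds (hz.prodMk_nhds hxz))
  have h2 := tendsto_initFilter_zero_sq (d := d) (L := L) (layerBlock h)
    (fun m w => randAverage σ c ψ x z h ⟨m, w⟩ - K (randGram σ c x x l ⟨m, w⟩)
      (randGram σ c z z l ⟨m, w⟩) (randGram σ c x z l ⟨m, w⟩)) ?_
    (fun X => c ^ 4 * (2 + 6 * (randGram σ c x x l X * randGram σ c z z l X)) * (X.1 : ℝ)⁻¹) ?_ ?_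
  · have h3 := h2.add h1
    simpa using h3
  · intro m
    refine Measurable.sub ?_ ?_
    · exact measurable_randAverage x z hσ hψ h m
    · exact hK.comp ((measurable_embeddingGram c x x hσ l).prodMk
        ((measurable_embeddingGram c z z hσ l).prodMk (measurable_embeddingGram c x z hσ l)))
  · have h3 := (((hx.mul hz).const_mul 6).const_add 2).const_mul (c ^ 4)
    simpa using h3.mul tendsto_width_inv
  -- The kernel identity `hint` needs nonzero embeddings, which positive limits of the Gram entries
  -- guarantee with high probability.
  · filter_upwards [eventually_embedding_ne_zero x hp hx, eventually_embedding_ne_zero z hq hz,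
      eventually_width_pos] with X hX hZ hm
    obtain ⟨m, w⟩ := X
    simp only at hX hZ hm ⊢
    set a := embedding σ c (WithLp.toLp 2 w : Params d m L) x l with ha
    set b := embedding σ c (WithLp.toLp 2 w : Params d m L) z l with hb'
    have hm' : (m : ℝ) ≠ 0 := by positivity
    have key := integral_row_stat hψ hb (weightIdx_injective2 (d := d) (m := m) h) a b (c ^ 2 / m)
    have heq : ∀ w', randAverage σ c ψ x z h ⟨m, resample (layerBlock h m) w' w⟩ -
        K (randGram σ c x x l ⟨m, resample (layerBlock h m) w' w⟩)
          (randGram σ c z z l ⟨m, resample (layerBlock h m) w' w⟩)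
          (randGram σ c x z l ⟨m, resample (layerBlock h m) w' w⟩) =
        c ^ 2 / m * ∑ i, (ψ (∑ j, w' (weightIdx h i j) * a j) * ψ (∑ j, w' (weightIdx h i j) * b j) -
          ∫ w, ψ (∑ j, w j * a j) * ψ (∑ j, w j * b j)
            ∂(Measure.pi fun _ => gaussianReal 0 1)) := by
      intro w'
      have h4 := hint _ a b hX hZ
      simp only [randAverage, randGram, embeddingGram_resample, preactivation_resample]
      change _ - K (inner ℝ a a) (inner ℝ b b) (inner ℝ a b) = _
      rw [← h4, Finset.sum_sub_distrib, mul_sub, Finset.sum_const, Finset.card_univ,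
        Fintype.card_fin, nsmul_eq_mul]
      congr 1
      field_simp
    simp only [heq]
    refine ⟨key.1, key.2.trans (le_of_eq ?_)⟩
    rw [Fintype.card_fin, ← real_inner_self_eq_norm_sq, ← real_inner_self_eq_norm_sq]
    change _ = c ^ 4 * (2 + 6 * (inner ℝ a a * inner ℝ b b)) * (m : ℝ)⁻¹
    field_simp

lemma randGram_succ {l : ℕ} (h : l < L) (X : Σ m, (ParamIdx d m L → ℝ)) :
    randGram σ c x z (l + 1) X = randAverage σ c σ x z h X := by
  have h1 : (c / √(X.1 : ℝ)) ^ 2 = c ^ 2 / X.1 := by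
    rw [div_pow, sq_sqrt (Nat.cast_nonneg _)]
  rw [randGram, embeddingGram_eq_sum, randAverage, ← h1, Finset.mul_sum]
  have h2 : ∀ i : Fin X.1, embedding σ c (WithLp.toLp 2 X.2 : Params d X.1 L) x (l + 1) i *
      embedding σ c (WithLp.toLp 2 X.2 : Params d X.1 L) z (l + 1) i = (c / √(X.1 : ℝ)) ^ 2 *
      (σ (preactivation σ c (WithLp.toLp 2 X.2 : Params d X.1 L) x h i) *
        σ (preactivation σ c (WithLp.toLp 2 X.2 : Params d X.1 L) z h i)) := by
    intro i
    rw [embedding_succ σ c _ x h i, embedding_succ σ c _ z h i]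
    ring
  exact Finset.sum_congr rfl fun i _ => h2 i

lemma gradGram_succ_eq_blockForm {m l : ℕ} (h : l < L) (i k : Fin m) (w : ParamIdx d m L → ℝ) :
    gradGram σ D c (WithLp.toLp 2 w : Params d m L) x z (l + 1) i k =
      c ^ 2 / m * (D (preactivation σ c (WithLp.toLp 2 w : Params d m L) x h i) *
        D (preactivation σ c (WithLp.toLp 2 w : Params d m L) z h k)) *
      (blockForm (gradGram σ D c (WithLp.toLp 2 w : Params d m L) x z l)
        (weightIdx h i) (weightIdx h k) w +
        if i = k then randGram σ c x z l ⟨m, w⟩ else 0) := by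
  rw [gradGram_succ σ D c _ x z h i k, div_pow, sq_sqrt (Nat.cast_nonneg _)]
  rfl

lemma abs_mul_le_one (hD : ∀ t, |D t| ≤ 1) (s t : ℝ) : |D s * D t| ≤ 1 := by
  rw [abs_mul]
  exact mul_le_one₀ (hD s) (abs_nonneg _) (hD t)

/-- The derivatives and the quadratic forms share the same rows, so their expectation does not
factor. Each form is replaced by its mean, the old trace, which pulls out of the average. By
Cauchy–Schwarz and `|D s * D t| ≤ 1` the error has conditional second moment at most `2 c⁴` times
the squared Frobenius norm. -/
lemma tendsto_randTrace_succ (hσ : Measurable σ) (hDm : Measurable D) (hD : ∀ t, |D t| ≤ 1) {l : ℕ}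
    (h : l < L) {κ r τ : ℝ} (hκ : Tendsto (randAverage σ c D x z h) (initFilter d L) (𝓝 κ))
    (hr : Tendsto (randGram σ c x z l) (initFilter d L) (𝓝 r))
    (hτ : Tendsto (randTrace σ D c x z l) (initFilter d L) (𝓝 τ))
    (hF : Tendsto (randFrob σ D c x z l) (initFilter d L) (𝓝 0)) :
    Tendsto (randTrace σ D c x z (l + 1)) (initFilter d L) (𝓝 ((r + τ) * κ)) := by
  have hmain : ∀ X : Σ m, (ParamIdx d m L → ℝ), randTrace σ D c x z (l + 1) X =
      (c ^ 2 / X.1 * ∑ i : Fin X.1,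
        (D (preactivation σ c (WithLp.toLp 2 X.2 : Params d X.1 L) x h i) *
          D (preactivation σ c (WithLp.toLp 2 X.2 : Params d X.1 L) z h i)) *
        (blockForm (gradGram σ D c (WithLp.toLp 2 X.2 : Params d X.1 L) x z l)
          (weightIdx h i) (weightIdx h i) X.2 - randTrace σ D c x z l X)) +
      (randGram σ c x z l X + randTrace σ D c x z l X) * randAverage σ c D x z h X := by
    intro X
    have h1 : randTrace σ D c x z (l + 1) X = ∑ i : Fin X.1,
        gradGram σ D c (WithLp.toLp 2 X.2 : Params d X.1 L) x z (l + 1) i i := rfl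
    rw [h1]
    simp only [gradGram_succ_eq_blockForm (m := X.1) x z h, if_true, randAverage, Finset.mul_sum]
    rw [← Finset.sum_add_distrib]
    exact Finset.sum_congr rfl fun i _ => by ring
  have h2 := tendsto_initFilter_zero_sq (d := d) (L := L) (layerBlock h)
    (fun m w => c ^ 2 / m * ∑ i : Fin m,
        (D (preactivation σ c (WithLp.toLp 2 w : Params d m L) x h i) *
          D (preactivation σ c (WithLp.toLp 2 w : Params d m L) z h i)) *
        (blockForm (gradGram σ D c (WithLp.toLp 2 w : Params d m L) x z l)
          (weightIdx h i) (weightIdx h i) w - randTrace σ D c x z l ⟨m, w⟩)) ?_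
    (fun X => c ^ 4 * (2 * randFrob σ D c x z l X)) ?_ ?_
  · rw [funext hmain]
    simpa using h2.add ((hr.add hτ).mul hκ)
  · intro m
    refine measurable_const.mul (Finset.measurable_sum _ fun i _ => ?_)
    refine Measurable.mul ?_ (Measurable.sub ?_ ?_)
    · exact (hDm.comp (measurable_preactivation c x hσ h i)).mul
        (hDm.comp (measurable_preactivation c z hσ h i))
    · exact Finset.measurable_sum _ fun a _ => Finset.measurable_sum _ fun b _ =>
        (measurable_gradGram c x z hσ hDm l a b).mul
          ((measurable_pi_apply _).mul (measurable_pi_apply _))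
    · exact measurable_randTrace x z hσ hDm l m
  · simpa using (hF.const_mul 2).const_mul (c ^ 4)
  · filter_upwards [eventually_width_pos] with X hm
    obtain ⟨m, w⟩ := X
    simp only at hm ⊢
    have hm' : (m : ℝ) ≠ 0 := by positivity
    set A := gradGram σ D c (WithLp.toLp 2 w : Params d m L) x z l with hA
    set a := embedding σ c (WithLp.toLp 2 w : Params d m L) x l with ha
    set b := embedding σ c (WithLp.toLp 2 w : Params d m L) z l with hb
    have hW : ∀ (w' : ParamIdx d m L → ℝ) (i k : Fin m),
        blockForm A (weightIdx h i) (weightIdx h k) (resample (layerBlock h m) w' w) =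
          blockForm A (weightIdx h i) (weightIdx h k) w' := by
      intro w' i k
      simp only [blockForm, resample_weightIdx]
    simp only [randTrace, gradGram_resample, preactivation_resample, ← hA, ← ha, ← hb, hW]
    set T := ∑ a, A a a with hT
    have hle : ∀ w' : ParamIdx d m L → ℝ, (c ^ 2 / m * ∑ i : Fin m,
        (D (∑ j, w' (weightIdx h i j) * a j) * D (∑ j, w' (weightIdx h i j) * b j)) *
        (blockForm A (weightIdx h i) (weightIdx h i) w' - T)) ^ 2 ≤
        c ^ 4 / m * ∑ i : Fin m, (blockForm A (weightIdx h i) (weightIdx h i) w' - T) ^ 2 := by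
      intro w'
      rw [mul_pow]
      have h3 : (∑ i : Fin m,
        (D (∑ j, w' (weightIdx h i j) * a j) * D (∑ j, w' (weightIdx h i j) * b j)) *
        (blockForm A (weightIdx h i) (weightIdx h i) w' - T)) ^ 2 ≤
          m * ∑ i : Fin m, (blockForm A (weightIdx h i) (weightIdx h i) w' - T) ^ 2 := by
        refine (sq_sum_le_card_mul_sum_sq).trans ?_
        rw [Finset.card_univ, Fintype.card_fin]
        refine mul_le_mul_of_nonneg_left (Finset.sum_le_sum fun i _ => ?_) (Nat.cast_nonneg _)
        rw [mul_pow, ← sq_abs (D _ * D _)]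
        exact mul_le_of_le_one_left (sq_nonneg _)
          (pow_le_one₀ (abs_nonneg _) (abs_mul_le_one hD _ _))
      refine (mul_le_mul_of_nonneg_left h3 (sq_nonneg _)).trans (le_of_eq ?_)
      field_simp
    have hsq : ∀ i : Fin m, Integrable
        (fun w' => (blockForm A (weightIdx h i) (weightIdx h i) w' - T) ^ 2)
        (Measure.pi fun _ : ParamIdx d m L => gaussianReal 0 1) := fun i =>
      ((memLp_blockForm A _ _).sub (memLp_const T)).integrable_sq
    have hdom : Integrable (fun w' => c ^ 4 / m * ∑ i : Fin m,
        (blockForm A (weightIdx h i) (weightIdx h i) w' - T) ^ 2)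
        (Measure.pi fun _ : ParamIdx d m L => gaussianReal 0 1) :=
      (integrable_finsetSum _ fun i _ => hsq i).const_mul _
    have hmeas : Measurable (fun w' : ParamIdx d m L → ℝ => (c ^ 2 / m * ∑ i : Fin m,
        (D (∑ j, w' (weightIdx h i j) * a j) * D (∑ j, w' (weightIdx h i j) * b j)) *
        (blockForm A (weightIdx h i) (weightIdx h i) w' - T)) ^ 2) := by
      refine (measurable_const.mul (Finset.measurable_sum _ fun i _ => ?_)).pow_const 2
      refine ((hDm.comp (by fun_prop)).mul (hDm.comp (by fun_prop))).mul ?_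
      exact (measurable_blockForm A _ _).sub measurable_const
    have hI : Integrable (fun w' : ParamIdx d m L → ℝ => (c ^ 2 / m * ∑ i : Fin m,
        (D (∑ j, w' (weightIdx h i j) * a j) * D (∑ j, w' (weightIdx h i j) * b j)) *
        (blockForm A (weightIdx h i) (weightIdx h i) w' - T)) ^ 2)
        (Measure.pi fun _ : ParamIdx d m L => gaussianReal 0 1) := by
      refine hdom.mono hmeas.aestronglyMeasurable (ae_of_all _ fun w' => ?_)
      rw [Real.norm_eq_abs, Real.norm_eq_abs, abs_of_nonneg (sq_nonneg _),
        abs_of_nonneg ((sq_nonneg _).trans (hle w'))]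
      exact hle w'
    refine ⟨hI, (integral_mono hI hdom hle).trans ?_⟩
    rw [integral_const_mul, integral_finsetSum _ fun i _ => hsq i]
    have h5 : ∑ i : Fin m, ∫ w', (blockForm A (weightIdx h i) (weightIdx h i) w' - T) ^ 2
        ∂(Measure.pi fun _ : ParamIdx d m L => gaussianReal 0 1) ≤
        ∑ i : Fin m, 2 * ∑ a, ∑ b, A a b ^ 2 :=
      Finset.sum_le_sum fun i _ =>
        integral_blockForm_sub_trace_sq_le (weightIdx_injective2 h) A i
    rw [Finset.sum_const, Finset.card_univ, Fintype.card_fin, nsmul_eq_mul] at h5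
    refine (mul_le_mul_of_nonneg_left h5 (by positivity)).trans (le_of_eq ?_)
    change _ = c ^ 4 * (2 * ∑ a, ∑ b, A a b ^ 2)
    field_simp

/-- Every entry carries a squared factor of order `1 / m²`. All `m²` entries cost a multiple of the
old squared norm, which tends to zero; the trace and the embedding term occur only on the `m`
diagonal entries and contribute order `1 / m`. -/
lemma tendsto_randFrob_succ (hσ : Measurable σ) (hDm : Measurable D) (hD : ∀ t, |D t| ≤ 1) {l : ℕ}
    (h : l < L) {r τ : ℝ} (hr : Tendsto (randGram σ c x z l) (initFilter d L) (𝓝 r))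
    (hτ : Tendsto (randTrace σ D c x z l) (initFilter d L) (𝓝 τ))
    (hF : Tendsto (randFrob σ D c x z l) (initFilter d L) (𝓝 0)) :
    Tendsto (randFrob σ D c x z (l + 1)) (initFilter d L) (𝓝 0) := by
  refine tendsto_initFilter_zero (d := d) (L := L) (layerBlock h)
    (fun m w => randFrob σ D c x z (l + 1) ⟨m, w⟩) ?_ ?_
    (fun X => 4 * c ^ 4 * randFrob σ D c x z l X +
      2 * c ^ 4 * (randTrace σ D c x z l X ^ 2 + randGram σ c x z l X ^ 2) * (X.1 : ℝ)⁻¹) ?_ ?_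
  · intro m
    exact measurable_randFrob x z hσ hDm (l + 1) m
  · intro m w
    exact Finset.sum_nonneg fun a _ => Finset.sum_nonneg fun b _ => sq_nonneg _
  · have h1 := (((hτ.pow 2).add (hr.pow 2)).const_mul (2 * c ^ 4)).mul tendsto_width_inv
    simpa using (hF.const_mul (4 * c ^ 4)).add h1
  · filter_upwards [eventually_width_pos] with X hm
    obtain ⟨m, w⟩ := X
    simp only at hm ⊢
    have hm' : (m : ℝ) ≠ 0 := by positivity
    set A := gradGram σ D c (WithLp.toLp 2 w : Params d m L) x z l with hA
    set G := randGram σ c x z l ⟨m, w⟩ with hG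
    set T := ∑ a, A a a with hT
    set F := ∑ a, ∑ b, A a b ^ 2 with hFdef
    have hF0 : 0 ≤ F := Finset.sum_nonneg fun a _ => Finset.sum_nonneg fun b _ => sq_nonneg _
    have hle : ∀ w' : ParamIdx d m L → ℝ,
        randFrob σ D c x z (l + 1) ⟨m, resample (layerBlock h m) w' w⟩ ≤
        2 * c ^ 4 / m ^ 2 * ∑ i : Fin m, ∑ k : Fin m,
          (blockForm A (weightIdx h i) (weightIdx h k) w' ^ 2 + if i = k then G ^ 2 else 0) := by
      intro w'
      have hentry : ∀ i k : Fin m, gradGram σ D c (WithLp.toLp 2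
          (resample (layerBlock h m) w' w) : Params d m L) x z (l + 1) i k ^ 2 ≤
          2 * c ^ 4 / m ^ 2 * (blockForm A (weightIdx h i) (weightIdx h k) w' ^ 2 +
            if i = k then G ^ 2 else 0) := ?_
      · simp only [Finset.mul_sum]
        exact Finset.sum_le_sum fun i _ => Finset.sum_le_sum fun k _ => hentry i k
      intro i k
      rw [gradGram_succ_eq_blockForm x z h i k, gradGram_resample, ← hA]
      have hW : blockForm A (weightIdx (m := m) h i) (weightIdx (m := m) h k)
          (resample (layerBlock h m) w' w) =
          blockForm A (weightIdx h i) (weightIdx h k) w' := by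
        simp only [blockForm, resample_weightIdx]
      have hG' : randGram σ c x z l ⟨m, resample (layerBlock h m) w' w⟩ = G := by
        simp only [randGram, embeddingGram_resample, hG]
      rw [hW, hG']
      set B := blockForm A (weightIdx (m := m) h i) (weightIdx (m := m) h k) w'
      set P := D (preactivation σ c (WithLp.toLp 2 (resample (layerBlock h m) w' w)) x h i) *
        D (preactivation σ c (WithLp.toLp 2 (resample (layerBlock h m) w' w)) z h k) with hP
      have hP2 : P ^ 2 ≤ 1 := by
        rw [← sq_abs]
        exact pow_le_one₀ (abs_nonneg _) (abs_mul_le_one hD _ _)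
      have h3 : (B + if i = k then G else 0) ^ 2 ≤
          2 * (B ^ 2 + if i = k then G ^ 2 else 0) := by
        split_ifs
        · nlinarith [sq_nonneg (B - G)]
        · nlinarith [sq_nonneg B]
      have h4 : (c ^ 2 / m * P * (B + if i = k then G else 0)) ^ 2 =
          (c ^ 4 / m ^ 2) * (P ^ 2 * (B + if i = k then G else 0) ^ 2) := by
        ring
      rw [h4, mul_comm 2 (c ^ 4), mul_div_right_comm, mul_assoc]
      refine mul_le_mul_of_nonneg_left ?_ (by positivity)
      exact (mul_le_of_le_one_left (sq_nonneg _) hP2).trans h3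
    have hterm : ∀ i k : Fin m, Integrable (fun w' =>
        (blockForm A (weightIdx h i) (weightIdx h k) w' ^ 2 + if i = k then G ^ 2 else 0))
        (Measure.pi fun _ : ParamIdx d m L => gaussianReal 0 1) := fun i k =>
      (integrable_blockForm_sq A _ _).add (integrable_const _)
    have hdom : Integrable (fun w' => 2 * c ^ 4 / m ^ 2 * ∑ i : Fin m, ∑ k : Fin m,
        (blockForm A (weightIdx h i) (weightIdx h k) w' ^ 2 + if i = k then G ^ 2 else 0))
        (Measure.pi fun _ : ParamIdx d m L => gaussianReal 0 1) :=
      (integrable_finsetSum _ fun i _ => integrable_finsetSum _ fun k _ => hterm i k).const_mul _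
    have hres : Measurable fun w' : ParamIdx d m L → ℝ => resample (layerBlock h m) w' w := by
      refine measurable_pi_lambda _ fun p => ?_
      by_cases hp : p ∈ layerBlock h m
      · simpa only [resample_of_mem hp] using measurable_pi_apply p
      · simp only [resample_of_notMem hp, measurable_const]
    have hmeas : Measurable fun w' : ParamIdx d m L → ℝ =>
        randFrob σ D c x z (l + 1) ⟨m, resample (layerBlock h m) w' w⟩ :=
      (measurable_randFrob x z hσ hDm (l + 1) m).comp hres
    have h0 : ∀ X : Σ m, (ParamIdx d m L → ℝ), 0 ≤ randFrob σ D c x z (l + 1) X := fun X =>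
      Finset.sum_nonneg fun a _ => Finset.sum_nonneg fun b _ => sq_nonneg _
    have hI : Integrable (fun w' : ParamIdx d m L → ℝ =>
        randFrob σ D c x z (l + 1) ⟨m, resample (layerBlock h m) w' w⟩)
        (Measure.pi fun _ : ParamIdx d m L => gaussianReal 0 1) := by
      refine hdom.mono hmeas.aestronglyMeasurable (ae_of_all _ fun w' => ?_)
      rw [Real.norm_eq_abs, Real.norm_eq_abs, abs_of_nonneg (h0 _),
        abs_of_nonneg ((h0 _).trans (hle w'))]
      exact hle w'
    refine ⟨hI, (integral_mono hI hdom hle).trans ?_⟩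
    rw [integral_const_mul, integral_finsetSum _ fun i _ => integrable_finsetSum _ fun k _ =>
      hterm i k]
    have h5 : ∑ i : Fin m, ∫ w', ∑ k : Fin m,
        (blockForm A (weightIdx h i) (weightIdx h k) w' ^ 2 + if i = k then G ^ 2 else 0)
        ∂(Measure.pi fun _ : ParamIdx d m L => gaussianReal 0 1) ≤
        ∑ i : Fin m, ∑ k : Fin m, (2 * F + if i = k then T ^ 2 + G ^ 2 else 0) := by
      refine Finset.sum_le_sum fun i _ => ?_
      rw [integral_finsetSum _ fun k _ => hterm i k]
      refine Finset.sum_le_sum fun k _ => ?_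
      rw [integral_add (integrable_blockForm_sq A _ _) (integrable_const _), integral_const,
        probReal_univ, one_smul]
      by_cases hik : i = k
      · subst hik
        have := integral_blockForm_sq_self_le (weightIdx_injective2 (d := d) (m := m) h) A i
        simp only [if_true]
        linarith
      · rw [integral_blockForm_sq_of_ne (weightIdx_injective2 (d := d) (m := m) h) A hik]
        simp only [hik, if_false]
        linarith
    have h6 : ∑ i : Fin m, ∑ k : Fin m, (2 * F + if i = k then T ^ 2 + G ^ 2 else 0) =
        m ^ 2 * (2 * F) + m * (T ^ 2 + G ^ 2) := by
      simp only [Finset.sum_add_distrib, Finset.sum_const, Finset.card_univ, Fintype.card_fin,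
        Finset.sum_ite_eq, Finset.mem_univ, if_true, nsmul_eq_mul]
      ring
    rw [h6] at h5
    refine (mul_le_mul_of_nonneg_left h5 (by positivity)).trans (le_of_eq ?_)
    change _ = 4 * c ^ 4 * F + 2 * c ^ 4 * (T ^ 2 + G ^ 2) * (m : ℝ)⁻¹
    field_simp
    ring

end Steps

/-- The limit of the normalized trace of the Gram matrix of the gradients of layer `l`. -/
def traceLimit (k₁ k₀ : ℝ → ℝ) (t : ℝ) : ℕ → ℝ
  | 0 => 0
  | l + 1 => (k₁^[l] t + traceLimit k₁ k₀ t l) * k₀ (k₁^[l] t)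

/-- The cosine of the model gradient angle of the infinitely wide network of depth `L`. -/
def limitCos (k₁ k₀ : ℝ → ℝ) (L : ℕ) (t : ℝ) : ℝ := (k₁^[L] t + traceLimit k₁ k₀ t L) / (L + 1)

/-! ### The infinite-width limit of the model gradient angle. -/

section Limits

variable {σ D : ℝ → ℝ} {c : ℝ} {k₁ k₀ : ℝ → ℝ} {d L : ℕ}

/-- At angle zero each layer adds `1`; this gives the factor `L + 1` in the squared norm of the
model gradient. -/
lemma traceLimit_one (h₁ : k₁ 1 = 1) (h₀ : k₀ 1 = 1) (l : ℕ) : traceLimit k₁ k₀ 1 l = l := by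
  induction l with
  | zero => simp [traceLimit]
  | succ l ih =>
    rw [traceLimit, ih, Function.iterate_fixed h₁, h₀]
    push_cast
    ring

lemma continuousAt_gram_kernel {k : ℝ → ℝ} (hk : Continuous k) {p q r : ℝ} (hp : 0 < p)
    (hq : 0 < q) :
    ContinuousAt (fun p : ℝ × ℝ × ℝ => k (p.2.2 / (√p.1 * √p.2.1))) (p, q, r) := by
  refine hk.continuousAt.comp (ContinuousAt.div (by fun_prop) (by fun_prop) ?_)
  exact (mul_pos (sqrt_pos.2 hp) (sqrt_pos.2 hq)).ne'

lemma gram_kernel_eq (k : ℝ → ℝ) {n : ℕ} (a b : EuclideanSpace ℝ (Fin n)) :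
    k (inner ℝ a b / (√(inner ℝ a a) * √(inner ℝ b b))) = k (cos (angle a b)) := by
  rw [real_inner_self_eq_norm_sq, real_inner_self_eq_norm_sq, sqrt_sq (norm_nonneg _),
    sqrt_sq (norm_nonneg _), cos_angle]

lemma sqrt_inner_self {n : ℕ} (a : EuclideanSpace ℝ (Fin n)) : √(inner ℝ a a) = ‖a‖ := by
  rw [real_inner_self_eq_norm_sq, sqrt_sq (norm_nonneg _)]

/-- The inputs are quantified inside the induction because the step for `(x, z)` also uses `(x, x)`
and `(z, z)`. Since `k₁ 1 = 1`, the norms are preserved in the limit and only the cosine evolves. -/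
lemma tendsto_randGram (hk : HasGaussianKernels σ D c k₁ k₀) : ∀ l, l ≤ L →
    ∀ x z : EuclideanSpace ℝ (Fin d), x ≠ 0 → z ≠ 0 →
      Tendsto (randGram σ c x z l) (initFilter d L)
        (𝓝 (‖x‖ * ‖z‖ * k₁^[l] (cos (angle x z)))) := by
  intro l
  induction l with
  | zero =>
    intro _ x z hx hz
    have h : ∀ X : Σ m, (ParamIdx d m L → ℝ), randGram σ c x z 0 X = inner ℝ x z := fun X => rfl
    have h1 : ‖x‖ * ‖z‖ * k₁^[0] (cos (angle x z)) = inner ℝ x z := by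
      rw [Function.iterate_zero, id, ← cos_angle_mul_norm_mul_norm x z]
      ring
    rw [funext h, h1]
    exact tendsto_const_nhds
  | succ l ih =>
    intro hl x z hx hz
    have h : l < L := hl
    have hself : ∀ y : EuclideanSpace ℝ (Fin d), y ≠ 0 →
        Tendsto (randGram σ c y y l) (initFilter d L) (𝓝 (‖y‖ ^ 2)) := by
      intro y hy
      have := ih h.le y y hy hy
      rwa [angle_self hy, cos_zero, Function.iterate_fixed hk.one_eq, mul_one, ← sq] at this
    have hx0 : 0 < ‖x‖ ^ 2 := pow_pos (norm_pos_iff.2 hx) 2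
    have hz0 : 0 < ‖z‖ ^ 2 := pow_pos (norm_pos_iff.2 hz) 2
    have key := tendsto_randAverage x z hk.measurable_act hk.measurable_act (c := c)
      (K := fun p q r => √p * √q * k₁ (r / (√p * √q))) (fun s t => ?_) ?_ ?_ h hx0 hz0
      (hself x hx) (hself z hz) (ih h.le x z hx hz) ?_
    · rw [funext (randGram_succ x z h)]
      convert! key using 2
      rw [sqrt_sq (norm_nonneg _), sqrt_sq (norm_nonneg _), Function.iterate_succ_apply',
        mul_div_cancel_left₀]
      exact mul_ne_zero (norm_ne_zero_iff.2 hx) (norm_ne_zero_iff.2 hz)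
    · rw [abs_mul, abs_mul]
      have := mul_le_mul (hk.abs_act_le s) (hk.abs_act_le t) (abs_nonneg _) (abs_nonneg _)
      linarith
    · have := hk.continuous_one.measurable
      fun_prop
    · intro n a b ha hb
      simp only [sqrt_inner_self]
      rw [hk.integral_act n a b ha hb, cos_angle]
    · exact ContinuousAt.mul (by fun_prop) (continuousAt_gram_kernel hk.continuous_one hx0 hz0)

lemma tendsto_randGram_self (hk : HasGaussianKernels σ D c k₁ k₀) {l : ℕ} (hl : l ≤ L)
    {x : EuclideanSpace ℝ (Fin d)} (hx : x ≠ 0) :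
    Tendsto (randGram σ c x x l) (initFilter d L) (𝓝 (‖x‖ ^ 2)) := by
  have := tendsto_randGram hk l hl x x hx hx
  rwa [angle_self hx, cos_zero, Function.iterate_fixed hk.one_eq, mul_one, ← sq] at this

lemma tendsto_randAverage_deriv (hk : HasGaussianKernels σ D c k₁ k₀) {l : ℕ} (h : l < L)
    {x z : EuclideanSpace ℝ (Fin d)} (hx : x ≠ 0) (hz : z ≠ 0) :
    Tendsto (randAverage σ c D x z h) (initFilter d L) (𝓝 (k₀ (k₁^[l] (cos (angle x z))))) := by
  have hx0 : 0 < ‖x‖ ^ 2 := pow_pos (norm_pos_iff.2 hx) 2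
  have hz0 : 0 < ‖z‖ ^ 2 := pow_pos (norm_pos_iff.2 hz) 2
  have key := tendsto_randAverage x z hk.measurable_act hk.measurable_deriv (c := c)
    (K := fun p q r => k₀ (r / (√p * √q))) (fun s t => ?_) ?_ ?_ h hx0 hz0
    (tendsto_randGram_self hk h.le hx) (tendsto_randGram_self hk h.le hz)
    (tendsto_randGram hk l h.le x z hx hz) ?_
  · convert! key using 2
    rw [sqrt_sq (norm_nonneg _), sqrt_sq (norm_nonneg _), mul_div_cancel_left₀]
    exact mul_ne_zero (norm_ne_zero_iff.2 hx) (norm_ne_zero_iff.2 hz)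
  · exact (abs_mul_le_one hk.abs_deriv_le s t).trans (le_add_of_nonneg_right (abs_nonneg _))
  · have := hk.continuous_zero.measurable
    fun_prop
  · intro n a b ha hb
    simp only [gram_kernel_eq]
    exact hk.integral_deriv n a b ha hb
  · exact continuousAt_gram_kernel hk.continuous_zero hx0 hz0

lemma tendsto_randTrace_randFrob (hk : HasGaussianKernels σ D c k₁ k₀)
    {x z : EuclideanSpace ℝ (Fin d)} (hx : x ≠ 0) (hz : z ≠ 0) : ∀ l, l ≤ L →
      Tendsto (randTrace σ D c x z l) (initFilter d L)
        (𝓝 (‖x‖ * ‖z‖ * traceLimit k₁ k₀ (cos (angle x z)) l)) ∧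
      Tendsto (randFrob σ D c x z l) (initFilter d L) (𝓝 0) := by
  intro l
  induction l with
  | zero =>
    intro _
    have h1 : ∀ X : Σ m, (ParamIdx d m L → ℝ), randTrace σ D c x z 0 X = 0 := by
      intro X
      simp [randTrace, gradGram, embeddingGrad]
    have h2 : ∀ X : Σ m, (ParamIdx d m L → ℝ), randFrob σ D c x z 0 X = 0 := by
      intro X
      simp [randFrob, gradGram, embeddingGrad]
    rw [funext h1, funext h2, traceLimit, mul_zero]
    exact ⟨tendsto_const_nhds, tendsto_const_nhds⟩
  | succ l ih =>
    intro hl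
    have h : l < L := hl
    obtain ⟨hT, hF⟩ := ih h.le
    have hG := tendsto_randGram hk l h.le x z hx hz
    refine ⟨?_, tendsto_randFrob_succ x z hk.measurable_act hk.measurable_deriv hk.abs_deriv_le
      h hG hT hF⟩
    have := tendsto_randTrace_succ x z hk.measurable_act hk.measurable_deriv hk.abs_deriv_le h
      (tendsto_randAverage_deriv hk h hx hz) hG hT hF
    convert! this using 2
    rw [traceLimit]
    ring

/-- The inner product of the gradients of the output at two inputs converges in probability. -/
lemma tendsto_inner_networkGrad (hk : HasGaussianKernels σ D c k₁ k₀)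
    {x z : EuclideanSpace ℝ (Fin d)} (hx : x ≠ 0) (hz : z ≠ 0) :
    Tendsto (fun X : Σ m, (ParamIdx d m L → ℝ) =>
      inner ℝ (networkGrad σ D c (WithLp.toLp 2 X.2 : Params d X.1 L) x)
        (networkGrad σ D c (WithLp.toLp 2 X.2 : Params d X.1 L) z)) (initFilter d L)
      (𝓝 (‖x‖ * ‖z‖ * ((L + 1) * limitCos k₁ k₀ L (cos (angle x z))))) := by
  obtain ⟨hT, hF⟩ := tendsto_randTrace_randFrob (L := L) hk hx hz L le_rfl
  have hG := tendsto_randGram (L := L) hk L le_rfl x z hx hz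
  have h1 := tendsto_initFilter_zero_sq (d := d) (L := L) (fun m => outputBlock m)
    (fun m w => blockForm (gradGram σ D c (WithLp.toLp 2 w : Params d m L) x z L)
      Sum.inr Sum.inr w - randTrace σ D c x z L ⟨m, w⟩) ?_
    (fun X => 2 * randFrob σ D c x z L X) ?_ ?_
  · have h2 := (h1.add hT).add hG
    convert! h2 using 2
    · rw [inner_networkGrad]
      simp [randGram, blockForm]
    · rw [limitCos]
      field_simp
      ring
  · intro m
    refine Measurable.sub ?_ (measurable_randTrace x z hk.measurable_act hk.measurable_deriv L m)
    simp only [blockForm]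
    refine Finset.measurable_sum _ fun a _ => Finset.measurable_sum _ fun b _ => ?_
    exact (measurable_gradGram c x z hk.measurable_act hk.measurable_deriv L a b).mul
      ((measurable_pi_apply _).mul (measurable_pi_apply _))
  · simpa using hF.const_mul 2
  · refine Eventually.of_forall fun X => ?_
    obtain ⟨m, w⟩ := X
    simp only
    set A := gradGram σ D c (WithLp.toLp 2 w : Params d m L) x z L with hA
    have hW : ∀ w' : ParamIdx d m L → ℝ,
        blockForm A Sum.inr Sum.inr (resample (outputBlock m) w' w) =
          blockForm A Sum.inr Sum.inr w' := by
      intro w'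
      have : ∀ j, resample (outputBlock m) w' w (Sum.inr j) = w' (Sum.inr j) :=
        fun j => resample_of_mem ⟨j, rfl⟩
      simp only [blockForm, this]
    simp only [randTrace, gradGram_resample_output, ← hA, hW]
    -- The output layer is a single weight row, hence the index type `Unit`.
    have he : Function.Injective2 (fun (_ : Unit) (j : Fin (layerWidth d m L)) =>
        (Sum.inr j : ParamIdx d m L)) := by
      intro i i' j j' h
      exact ⟨rfl, Sum.inr_injective h⟩
    have h2 : MemLp (fun w' : ParamIdx d m L → ℝ => blockForm A Sum.inr Sum.inr w' - ∑ a, A a a) 2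
        (Measure.pi fun _ : ParamIdx d m L => gaussianReal 0 1) :=
      (memLp_blockForm A Sum.inr Sum.inr).sub (memLp_const _)
    have h3 := integral_blockForm_sub_trace_sq_le he A ()
    exact ⟨h2.integrable_sq, h3⟩

/-- With asymptotically full probability no unit is at the kink of the activation. -/
lemma eventually_preactivation_ne_zero (hk : HasGaussianKernels σ D c k₁ k₀)
    {x : EuclideanSpace ℝ (Fin d)} (hx : x ≠ 0) :
    ∀ᶠ X in initFilter d L, ∀ l (h : l < L) i,
      preactivation σ c (WithLp.toLp 2 X.2 : Params d X.1 L) x h i ≠ 0 := by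
  have key : ∀ l : Fin L, ∀ᶠ X in initFilter d L, ∀ i,
      preactivation σ c (WithLp.toLp 2 X.2 : Params d X.1 L) x l.2 i ≠ 0 := by
    rintro ⟨l, h⟩
    -- If the embedding vanishes then all preactivations do, so the bad event is restricted to a
    -- nonzero embedding. Given the lower layers it is then a finite union of null hyperplanes; the
    -- excluded case is improbable because the Gram entry tends to `‖x‖ ^ 2 > 0`.
    have h1 := eventually_whp_of_piecewise (ι := fun m => ParamIdx d m L)
      (ν := fun _ _ => gaussianReal 0 1) (layerBlock h)
      (fun m => {w | randGram σ c x x l ⟨m, w⟩ ≠ 0} ∩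
        ⋃ i, {w | preactivation σ c (WithLp.toLp 2 w : Params d m L) x h i = 0}) ?_ ?_
    · filter_upwards [h1, (tendsto_randGram_self hk h.le hx).eventually_ne
        (pow_pos (norm_pos_iff.2 hx) 2).ne'] with X hX hG i hi
      exact hX ⟨hG, mem_iUnion.2 ⟨i, hi⟩⟩
    · intro m
      refine MeasurableSet.inter ?_ (MeasurableSet.iUnion fun i => ?_)
      · exact (measurable_randGram x x hk.measurable_act l m (measurableSet_singleton 0)).compl
      · exact measurable_preactivation c x hk.measurable_act h i (measurableSet_singleton 0)
    · refine tendsto_const_nhds.congr fun X => ?_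
      obtain ⟨m, w⟩ := X
      symm
      set a := embedding σ c (WithLp.toLp 2 w : Params d m L) x l with ha
      by_cases ha0 : a = 0
      · refine measure_mono_null (t := ∅) ?_ measure_empty
        rintro w' ⟨hw', -⟩
        refine hw' ?_
        change randGram σ c x x l ⟨m, resample (layerBlock h m) w' w⟩ = 0
        rw [randGram, embeddingGram_resample, embeddingGram, ← ha, ha0, inner_zero_left]
      · refine measure_mono_null (t := ⋃ i, {w' | ∑ j, w' (weightIdx h i j) * a j = 0}) ?_ ?_
        · rintro w' ⟨-, hw'⟩
          obtain ⟨i, hi⟩ := mem_iUnion.1 hw'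
          refine mem_iUnion.2 ⟨i, ?_⟩
          have h2 : preactivation σ c (WithLp.toLp 2 (resample (layerBlock h m) w' w) :
            Params d m L) x h i = 0 := hi
          rwa [preactivation_resample, ← ha] at h2
        · rw [measure_iUnion_null_iff]
          intro i
          have hp := measurePreserving_block (gaussianReal 0 1)
            (weightIdx_injective2 (d := d) (m := m) h) i
          have hs : MeasurableSet {v : Fin (layerWidth d m l) → ℝ | ∑ j, v j * a j = 0} :=
            (by fun_prop : Measurable fun v : Fin (layerWidth d m l) → ℝ => ∑ j, v j * a j)
              (measurableSet_singleton 0)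
          have h3 := hp.measure_preimage hs.nullMeasurableSet
          rw [pi_gaussian_sum_eq_zero ha0] at h3
          exact h3
  filter_upwards [eventually_all.2 key] with X hX l h i
  exact hX ⟨l, h⟩ i

/-- The flattening map is a measurable equivalence, so its pushforward formula holds for every set
and measurability of the true gradient angle is not needed. -/
lemma isInfiniteWidthAngle_of_tendsto {x z : EuclideanSpace ℝ (Fin d)} {φ : ℝ}
    (h : Tendsto (fun X : Σ m, (ParamIdx d m L → ℝ) =>
      modelGradientAngle σ c (WithLp.toLp 2 X.2 : Params d X.1 L) x z) (initFilter d L) (𝓝 φ)) :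
    IsInfiniteWidthAngle σ c L x z φ := by
  intro ε hε
  have h1 := (Metric.tendsto_nhds.1 h) ε hε
  rw [initFilter, eventually_whp] at h1
  refine h1.congr fun m => ?_
  have h2 : initLaw d m L = (Measure.pi fun _ : ParamIdx d m L => gaussianReal 0 1).map
      (MeasurableEquiv.toLp 2 (ParamIdx d m L → ℝ)) := rfl
  rw [h2, MeasurableEquiv.map_apply]
  congr 1
  ext w
  simp [Real.dist_eq]

/-- The model gradient angle of an infinitely wide network. -/
theorem isInfiniteWidthAngle_arccos (hk : HasGaussianKernels σ D c k₁ k₀)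
    {x z : EuclideanSpace ℝ (Fin d)} (hx : x ≠ 0) (hz : z ≠ 0) :
    IsInfiniteWidthAngle σ c L x z (arccos (limitCos k₁ k₀ L (cos (angle x z)))) := by
  refine isInfiniteWidthAngle_of_tendsto ?_
  have hself : ∀ y : EuclideanSpace ℝ (Fin d), y ≠ 0 →
      Tendsto (fun X : Σ m, (ParamIdx d m L → ℝ) =>
        ‖networkGrad σ D c (WithLp.toLp 2 X.2 : Params d X.1 L) y‖) (initFilter d L)
        (𝓝 (‖y‖ * √(L + 1))) := by
    intro y hy
    have h1 := (continuous_sqrt.tendsto _).comp (tendsto_inner_networkGrad (L := L) hk hy hy)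
    convert! h1 using 2
    · simp only [Function.comp, real_inner_self_eq_norm_sq, sqrt_sq (norm_nonneg _)]
    · rw [angle_self hy, cos_zero, limitCos, Function.iterate_fixed hk.one_eq,
        traceLimit_one hk.one_eq hk.zero_eq, ← sq, sqrt_mul (sq_nonneg _), sqrt_sq (norm_nonneg _)]
      congr 2
      field_simp
      ring
  have hL : (0 : ℝ) < L + 1 := by positivity
  have hx' := norm_ne_zero_iff.2 hx
  have hz' := norm_ne_zero_iff.2 hz
  have hs : √((L : ℝ) + 1) ≠ 0 := (sqrt_pos.2 hL).ne'
  have h2 := (tendsto_inner_networkGrad (L := L) hk hx hz).div ((hself x hx).mul (hself z hz))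
    (mul_ne_zero (mul_ne_zero hx' hs) (mul_ne_zero hz' hs))
  have h3 := (continuous_arccos.tendsto _).comp h2
  have h4 : ‖x‖ * ‖z‖ * ((L + 1) * limitCos k₁ k₀ L (cos (angle x z))) /
      (‖x‖ * √(L + 1) * (‖z‖ * √(L + 1))) = limitCos k₁ k₀ L (cos (angle x z)) := by
    rw [show ‖x‖ * √((L : ℝ) + 1) * (‖z‖ * √((L : ℝ) + 1)) =
      ‖x‖ * ‖z‖ * (√((L : ℝ) + 1) * √((L : ℝ) + 1)) by ring, Real.mul_self_sqrt hL.le]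
    field_simp
  rw [h4] at h3
  -- The limit is known for the formal gradients; they agree with the true ones on the event that no
  -- preactivation vanishes at `x` or `z`.
  refine h3.congr' ?_
  filter_upwards [eventually_preactivation_ne_zero hk hx, eventually_preactivation_ne_zero hk hz]
    with X hX hZ
  rw [modelGradientAngle, modelGradient_eq c _ x hk.hasDerivAt hX,
    modelGradient_eq c _ z hk.hasDerivAt hZ]
  rfl

end Limits

/-! ### The ReLU and the linear network. -/

section Activations

lemma arccosKernelOne_one : arccosKernelOne 1 = 1 := by
  simp [arccosKernelOne]

lemma hasGaussianKernels_relu :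
    HasGaussianKernels (fun t => max 0 t) reluDeriv (√2) arccosKernelOne arccosKernelZero where
  measurable_act := by fun_prop
  measurable_deriv := measurable_reluDeriv
  abs_act_le t := by
    rw [abs_of_nonneg (le_max_left _ _)]
    exact max_le (abs_nonneg t) (le_abs_self t)
  abs_deriv_le t := by
    unfold reluDeriv
    split_ifs <;> simp
  hasDerivAt t ht := by
    rcases lt_or_gt_of_ne ht with h | h
    · have h1 : (fun t : ℝ => max 0 t) =ᶠ[𝓝 t] fun _ => 0 := by
        filter_upwards [gt_mem_nhds h] with s hs
        exact max_eq_left (le_of_lt hs)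
      simpa [reluDeriv, h.le.not_gt] using (hasDerivAt_const t (0 : ℝ)).congr_of_eventuallyEq h1
    · have h1 : (fun t : ℝ => max 0 t) =ᶠ[𝓝 t] fun s => s := by
        filter_upwards [lt_mem_nhds h] with s hs
        exact max_eq_right (le_of_lt hs)
      simpa [reluDeriv, h] using (hasDerivAt_id' t).congr_of_eventuallyEq h1
  continuous_one := by
    unfold arccosKernelOne
    have := continuous_arccos
    fun_prop
  continuous_zero := by
    unfold arccosKernelZero
    have := continuous_arccos
    fun_prop
  one_eq := arccosKernelOne_one
  zero_eq := by simp [arccosKernelZero]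
  integral_act n a b _ _ := by
    rw [integral_relu_mul_relu, sq_sqrt (by norm_num)]
    ring
  integral_deriv n a b ha hb := by
    rw [integral_reluDeriv_mul_reluDeriv ha hb, sq_sqrt (by norm_num)]
    ring

lemma hasGaussianKernels_linear :
    HasGaussianKernels (fun t => t) (fun _ => 1) 1 (fun t => t) (fun _ => 1) where
  measurable_act := measurable_id
  measurable_deriv := measurable_const
  abs_act_le _ := le_rfl
  abs_deriv_le _ := by simp
  hasDerivAt t _ := hasDerivAt_id' t
  continuous_one := continuous_id
  continuous_zero := continuous_const
  one_eq := rfl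
  zero_eq := rfl
  integral_act n a b _ _ := by
    have he : Function.Injective2 fun (_ : Unit) (j : Fin n) => j := fun _ _ _ _ h => ⟨rfl, h⟩
    have h1 := integral_blockForm_self he (fun j k => a j * b k) ()
    simp only [← row_mul_row (fun (_ : Unit) (j : Fin n) => j) ()] at h1
    rw [h1, ← mul_comm (cos _), mul_comm, cos_angle_mul_norm_mul_norm]
    simp [PiLp.inner_apply, mul_comm]
  integral_deriv n a b _ _ := by simp

lemma limitCos_linear (L : ℕ) (t : ℝ) : limitCos (fun t => t) (fun _ => 1) L t = t := by
  have h1 : ∀ l : ℕ, (fun t : ℝ => t)^[l] t = t := fun l => Function.iterate_fixed rfl l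
  have h2 : ∀ l : ℕ, traceLimit (fun t => t) (fun _ => 1) t l = l * t := by
    intro l
    induction l with
    | zero => simp [traceLimit]
    | succ l ih =>
      rw [traceLimit, ih, h1]
      push_cast
      ring
  rw [limitCos, h1, h2]
  field_simp
  ring

theorem isLinearAngle_angle {d L : ℕ} {x z : EuclideanSpace ℝ (Fin d)} (hx : x ≠ 0) (hz : z ≠ 0) :
    IsLinearAngle L x z (angle x z) := by
  have h := isInfiniteWidthAngle_arccos (L := L) hasGaussianKernels_linear hx hz
  rwa [limitCos_linear, arccos_cos (angle_nonneg x z) (angle_le_pi x z)] at h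

/-- The model gradient angle of the infinitely wide ReLU network as a function of the input
angle. -/
def reluAngle (L : ℕ) (θ : ℝ) : ℝ := arccos (limitCos arccosKernelOne arccosKernelZero L (cos θ))

theorem isReLUAngle_reluAngle {d L : ℕ} {x z : EuclideanSpace ℝ (Fin d)} (hx : x ≠ 0)
    (hz : z ≠ 0) : IsReLUAngle L x z (reluAngle L (angle x z)) :=
  isInfiniteWidthAngle_arccos hasGaussianKernels_relu hx hz

end Activations

/-! ### Expansion in depth at small input angles. -/

section DepthExpansion

lemma mul_cos_le_sin {θ : ℝ} (h0 : 0 ≤ θ) (h1 : θ ≤ π / 2) : θ * cos θ ≤ sin θ := by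
  rcases h1.lt_or_eq with h | h
  · have h2 := le_tan h0 h
    have h3 : 0 < cos θ := cos_pos_of_mem_Ioo ⟨by linarith [pi_pos], h⟩
    rwa [tan_eq_sin_div_cos, le_div_iff₀ h3] at h2
  · rw [h, cos_pi_div_two, sin_pi_div_two, mul_zero]
    exact zero_le_one

/-- One layer contracts the angle between the embeddings by at most a quadratic amount. -/
lemma exists_angle_arccosKernelOne {θ : ℝ} (h0 : 0 ≤ θ) (h1 : θ ≤ π / 2) :
    ∃ t, arccosKernelOne (cos θ) = cos t ∧ 0 ≤ t ∧ t ≤ θ ∧ θ - θ ^ 2 ≤ t := by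
  have hπ := pi_pos
  have hc : 0 ≤ cos θ := cos_nonneg_of_mem_Icc ⟨by linarith, h1⟩
  have hk : arccosKernelOne (cos θ) = cos θ + (sin θ - θ * cos θ) / π := by
    rw [arccosKernelOne_cos h0 (by linarith)]
    field_simp
    ring
  have hnn := mul_cos_le_sin h0 h1
  have hge : cos θ ≤ arccosKernelOne (cos θ) := by
    rw [hk]
    exact le_add_of_nonneg_right (div_nonneg (sub_nonneg.2 hnn) hπ.le)
  have hle1 : arccosKernelOne (cos θ) ≤ 1 := by
    rw [arccosKernelOne_cos h0 (by linarith), div_le_one hπ]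
    nlinarith [sin_le h0, cos_le_one θ]
  have hcos : cos (arccos (arccosKernelOne (cos θ))) = arccosKernelOne (cos θ) :=
    cos_arccos (by linarith) hle1
  have hgle : arccos (arccosKernelOne (cos θ)) ≤ θ := by
    have := arccos_le_arccos hge
    rwa [arccos_cos h0 (by linarith)] at this
  refine ⟨arccos (arccosKernelOne (cos θ)), hcos.symm, arccos_nonneg _, hgle, ?_⟩
  set g := arccos (arccosKernelOne (cos θ)) with hg
  have hg0 : 0 ≤ g := arccos_nonneg _
  rcases h0.eq_or_lt with h | hpos
  · have : θ - θ ^ 2 = 0 := by rw [← h]; norm_num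
    linarith
  -- The difference is `(sin θ - θ * cos θ) / π`; use `sin θ ≤ θ` and `cos θ ≥ 1 - θ ^ 2 / 2`.
  have hup : cos g - cos θ ≤ θ ^ 3 / (2 * π) := by
    rw [hcos, hk, add_sub_cancel_left, div_le_div_iff₀ hπ (by positivity)]
    nlinarith [sin_le h0, one_sub_sq_div_two_le_cos (x := θ), mul_nonneg h0 hπ.le]
  -- Write the difference as a product of two sines and apply Jordan's inequality to both. With
  -- `hup` this yields `θ - g ≤ (π / 4) * θ ^ 2`, and `π ≤ 4` finishes.
  have hlow : 2 / π ^ 2 * (θ * (θ - g)) ≤ cos g - cos θ := by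
    have e : cos g - cos θ = 2 * sin ((θ + g) / 2) * sin ((θ - g) / 2) := by
      rw [cos_sub_cos, ← neg_sub θ g, neg_div, sin_neg, add_comm g θ]
      ring
    have s1 := mul_le_sin (x := (θ + g) / 2) (by linarith) (by linarith)
    have s2 := mul_le_sin (x := (θ - g) / 2) (by linarith) (by linarith)
    have s3 := mul_le_mul s1 s2 (by have : 0 ≤ θ - g := by linarith
                                    positivity)
      (le_trans (by positivity) s1)
    rw [e]
    have e2 : 2 / π * ((θ + g) / 2) * (2 / π * ((θ - g) / 2)) =
        (θ + g) * (θ - g) / π ^ 2 := by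
      field_simp
    rw [e2] at s3
    have s4 : θ * (θ - g) / π ^ 2 ≤ (θ + g) * (θ - g) / π ^ 2 := by
      gcongr
      linarith
    have e3 : 2 / π ^ 2 * (θ * (θ - g)) = 2 * (θ * (θ - g) / π ^ 2) := by ring
    rw [e3]
    linarith
  have h3 := hlow.trans hup
  rw [div_mul_eq_mul_div, div_le_div_iff₀ (by positivity) (by positivity)] at h3
  have h4 : (4 * π * θ) * (θ - g) ≤ (4 * π * θ) * (π / 4 * θ ^ 2) := by
    nlinarith
  have h5 := le_of_mul_le_mul_left h4 (by positivity)
  nlinarith [pi_le_four, sq_nonneg θ]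

/-- The angles decrease, so every layer loses at most `θ ^ 2`. -/
lemma exists_angle_iterate {θ : ℝ} (h0 : 0 ≤ θ) (h1 : θ ≤ π / 2) (l : ℕ) :
    ∃ t, arccosKernelOne^[l] (cos θ) = cos t ∧ 0 ≤ t ∧ t ≤ θ ∧ θ - l * θ ^ 2 ≤ t := by
  induction l with
  | zero => exact ⟨θ, rfl, h0, le_rfl, by simp⟩
  | succ l ih =>
    obtain ⟨t, ht, ht0, ht1, ht2⟩ := ih
    obtain ⟨u, hu, hu0, hu1, hu2⟩ := exists_angle_arccosKernelOne ht0 (ht1.trans h1)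
    refine ⟨u, ?_, hu0, hu1.trans ht1, ?_⟩
    · rw [Function.iterate_succ_apply', ht, hu]
    · push_cast
      nlinarith [pow_le_pow_left₀ ht0 ht1 2]

/-- The unnormalized limit of the cosine of the model gradient angle. -/
def kernelSum (L : ℕ) (θ : ℝ) : ℝ :=
  (L + 1) * limitCos arccosKernelOne arccosKernelZero L (cos θ)

lemma kernelSum_eq (L : ℕ) (θ : ℝ) : kernelSum L θ =
    arccosKernelOne^[L] (cos θ) + traceLimit arccosKernelOne arccosKernelZero (cos θ) L := by
  rw [kernelSum, limitCos]
  field_simp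

lemma limitCos_eq (L : ℕ) (θ : ℝ) :
    limitCos arccosKernelOne arccosKernelZero L (cos θ) = kernelSum L θ / (L + 1) := by
  rw [kernelSum]
  field_simp

lemma kernelSum_zero (θ : ℝ) : kernelSum 0 θ = cos θ := by
  rw [kernelSum_eq]
  simp [traceLimit]

/-- The recursion over the depth, in terms of the angles between the embeddings. -/
lemma exists_kernelSum_succ {θ : ℝ} (h0 : 0 ≤ θ) (h1 : θ ≤ π / 2) (L : ℕ) :
    ∃ t ρ, 0 ≤ t ∧ t ≤ θ ∧ θ - L * θ ^ 2 ≤ t ∧ cos θ ≤ ρ ∧ ρ ≤ 1 ∧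
      kernelSum (L + 1) θ = ρ + kernelSum L θ * (1 - t / π) := by
  have hπ := pi_pos
  obtain ⟨t, ht, ht0, ht1, ht2⟩ := exists_angle_iterate h0 h1 L
  obtain ⟨u, hu, hu0, hu1, -⟩ := exists_angle_iterate h0 h1 (L + 1)
  refine ⟨t, cos u, ht0, ht1, ht2, cos_le_cos_of_nonneg_of_le_pi hu0 (by linarith) hu1,
    cos_le_one u, ?_⟩
  rw [kernelSum_eq, kernelSum_eq, hu, traceLimit, ht, arccosKernelZero,
    arccos_cos ht0 (by linarith)]

/-- Replacing `t` by `θ` and `ρ` by `cos θ` in the recursion only lowers it. The lower bound then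
propagates with slack of second order in `θ`; keeping `cos θ` as a factor makes the later division
by it exact. -/
lemma kernelSum_bounds {θ : ℝ} (h0 : 0 ≤ θ) (h1 : θ ≤ π / 2) (L : ℕ) :
    0 ≤ kernelSum L θ ∧ kernelSum L θ ≤ L + 1 ∧
      cos θ * ((L + 1) * (1 - L * θ / (2 * π))) ≤ kernelSum L θ := by
  have hπ := pi_pos
  have hc : 0 ≤ cos θ := cos_nonneg_of_mem_Icc ⟨by linarith, h1⟩
  induction L with
  | zero =>
    rw [kernelSum_zero]
    refine ⟨hc, ?_, ?_⟩
    · simpa using cos_le_one θ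
    · simp
  | succ L ih =>
    obtain ⟨t, ρ, ht0, ht1, -, hρ, hρ1, heq⟩ := exists_kernelSum_succ h0 h1 L
    obtain ⟨ih0, ih1, ih2⟩ := ih
    have ht : 0 ≤ t / π := by positivity
    have htθ : t / π ≤ θ / π := by gcongr
    have hθ1 : θ / π ≤ 1 := by rw [div_le_one hπ]; linarith
    rw [heq]
    refine ⟨?_, ?_, ?_⟩
    · have := mul_nonneg ih0 (by linarith : 0 ≤ 1 - t / π)
      linarith
    · push_cast
      nlinarith [mul_nonneg ih0 ht]
    · have h3 : kernelSum L θ * (1 - θ / π) ≤ kernelSum L θ * (1 - t / π) :=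
        mul_le_mul_of_nonneg_left (by linarith) ih0
      have h4 : cos θ * ((L + 1) * (1 - L * θ / (2 * π))) * (1 - θ / π) ≤
          kernelSum L θ * (1 - θ / π) :=
        mul_le_mul_of_nonneg_right ih2 (by linarith)
      have h5 : cos θ * (((L + 1 : ℕ) + 1) * (1 - (L + 1 : ℕ) * θ / (2 * π))) =
          cos θ + cos θ * ((L + 1) * (1 - L * θ / (2 * π))) * (1 - θ / π) -
            cos θ * ((L + 1) * L * (θ / π) ^ 2 / 2) := by
        push_cast
        field_simp
        ring
      have h6 : 0 ≤ cos θ * ((L + 1) * L * (θ / π) ^ 2 / 2) := by positivity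
      rw [h5]
      linarith

/-- With `y = (L + 1) * θ`, the true loss of a layer is at least `y / π - y ^ 2`. The terms `y / π`
add up to the linear loss, and the sum of the errors `y ^ 2` stays below `L ^ 3 * θ ^ 2`. -/
lemma kernelSum_le {θ : ℝ} (h0 : 0 ≤ θ) (L : ℕ) (hL : L * θ ≤ 1) (hθ : θ ≤ 1) :
    kernelSum L θ ≤ (L + 1) * (1 - L * θ / (2 * π)) + L ^ 3 * θ ^ 2 := by
  have hπ := pi_pos
  have hπ3 := pi_gt_three
  induction L with
  | zero => simpa [kernelSum_zero] using cos_le_one θ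
  | succ L ih =>
    have h1 : θ ≤ π / 2 := by linarith
    push_cast at hL
    have ih' := ih (by linarith)
    obtain ⟨t, ρ, ht0, ht1, ht2, hρ, hρ1, heq⟩ := exists_kernelSum_succ h0 h1 L
    obtain ⟨hs0, -, hs2⟩ := kernelSum_bounds h0 h1 L
    set y : ℝ := (L + 1) * θ with hy
    have hLn : (0 : ℝ) ≤ L := Nat.cast_nonneg L
    have hLy : L * θ ≤ y := by rw [hy]; nlinarith
    have hθy : θ ≤ y := by rw [hy]; nlinarith
    have hL0 : 0 ≤ L * θ := by positivity
    have hy1 : y ≤ 1 := by rw [hy]; linarith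
    have hy0 : 0 ≤ y := h0.trans hθy
    have hcos : 1 - θ / 2 ≤ cos θ := by
      have := one_sub_sq_div_two_le_cos (x := θ)
      nlinarith
    have hq : 1 - L * θ / 2 ≤ 1 - L * θ / (2 * π) := by
      have : L * θ / (2 * π) ≤ L * θ / 2 := by
        apply div_le_div_of_nonneg_left hL0 (by norm_num) (by linarith)
      linarith
    have hS : (L + 1) * (1 - y) ≤ kernelSum L θ := by
      have h3 : (1 - θ / 2) * (1 - L * θ / 2) ≤ cos θ * (1 - L * θ / (2 * π)) :=
        mul_le_mul hcos hq (by linarith) (by linarith)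
      have h4 : 1 - y ≤ (1 - θ / 2) * (1 - L * θ / 2) := by nlinarith [mul_nonneg h0 hL0]
      calc (L + 1) * (1 - y) ≤ (L + 1) * (cos θ * (1 - L * θ / (2 * π))) := by
            gcongr
            exact h4.trans h3
        _ = cos θ * ((L + 1) * (1 - L * θ / (2 * π))) := by ring
        _ ≤ _ := hs2
    have ht : θ * (1 - y) ≤ t := by nlinarith
    have hSt : (L + 1) * (1 - y) * (θ * (1 - y)) ≤ kernelSum L θ * t :=
      mul_le_mul hS ht (mul_nonneg h0 (by linarith)) hs0
    have hSt' : y * (1 - 2 * y) ≤ kernelSum L θ * t := by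
      refine le_trans ?_ hSt
      have : (L + 1) * (1 - y) * (θ * (1 - y)) = y * (1 - y) ^ 2 := by rw [hy]; ring
      rw [this]
      nlinarith [pow_nonneg hy0 3]
    have hdiv : y / π - y ^ 2 ≤ kernelSum L θ * t / π := by
      have h5 : y * (1 - 2 * y) / π ≤ kernelSum L θ * t / π := by gcongr
      have h6 : y ^ 2 * (2 / π) ≤ y ^ 2 := by
        refine mul_le_of_le_one_right (sq_nonneg y) ?_
        rw [div_le_one hπ]
        linarith
      have h7 : y * (1 - 2 * y) / π = y / π - y ^ 2 * (2 / π) := by ring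
      linarith
    have h8 : kernelSum (L + 1) θ ≤ 1 + kernelSum L θ - (y / π - y ^ 2) := by
      rw [heq]
      have : kernelSum L θ * (1 - t / π) = kernelSum L θ - kernelSum L θ * t / π := by ring
      linarith
    have h9 : ((L + 1 : ℕ) + 1 : ℝ) * (1 - (L + 1 : ℕ) * θ / (2 * π)) =
        1 + (L + 1) * (1 - L * θ / (2 * π)) - y / π := by
      rw [hy]
      push_cast
      field_simp
      ring
    have h10 : (L : ℝ) ^ 3 * θ ^ 2 + y ^ 2 ≤ ((L + 1 : ℕ) : ℝ) ^ 3 * θ ^ 2 := by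
      rw [hy]
      push_cast
      have : 0 ≤ θ ^ 2 * (2 * L ^ 2 + L) := by positivity
      nlinarith
    rw [h9]
    linarith

/-- The remainder in the expansion of the model gradient angle for small input angles. -/
def remainder (L : ℕ) (θ : ℝ) : ℝ :=
  limitCos arccosKernelOne arccosKernelZero L (cos θ) / cos θ - 1 + L / (2 * π) * θ

lemma limitCos_eq_remainder {L : ℕ} {θ : ℝ} (h : cos θ ≠ 0) :
    limitCos arccosKernelOne arccosKernelZero L (cos θ) =
      (1 - L / (2 * π) * θ + remainder L θ) * cos θ := by
  rw [remainder]
  field_simp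
  ring

lemma limitCos_mem {L : ℕ} {θ : ℝ} (h0 : 0 ≤ θ) (h1 : θ ≤ π / 2) :
    limitCos arccosKernelOne arccosKernelZero L (cos θ) ∈ Icc 0 1 := by
  obtain ⟨h2, h3, -⟩ := kernelSum_bounds h0 h1 L
  rw [limitCos_eq]
  exact ⟨by positivity, by rw [div_le_one (by positivity)]; exact h3⟩

lemma cos_reluAngle {L : ℕ} {θ : ℝ} (h0 : 0 ≤ θ) (h1 : θ ≤ π / 2) :
    cos (reluAngle L θ) = limitCos arccosKernelOne arccosKernelZero L (cos θ) := by
  obtain ⟨h2, h3⟩ := limitCos_mem (L := L) h0 h1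
  exact cos_arccos (by linarith) h3

/-- The bound is quadratic in the joint variable `L * θ` with an absolute constant, so it serves
both the fixed-depth and the uniform little-o claim. -/
lemma abs_remainder_le {L : ℕ} {θ : ℝ} (hL1 : 1 ≤ L) (h0 : 0 ≤ θ) (hL : L * θ ≤ 1) :
    |remainder L θ| ≤ 3 * (L * θ) ^ 2 := by
  have hπ := pi_pos
  have hπ3 := pi_gt_three
  have hL1' : (1 : ℝ) ≤ L := by exact_mod_cast hL1
  have hθ : θ ≤ L * θ := by nlinarith
  have h1 : θ ≤ π / 2 := by linarith
  have hcos : 1 - θ ^ 2 / 2 ≤ cos θ := one_sub_sq_div_two_le_cos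
  have hc : 0 < cos θ := by nlinarith
  obtain ⟨hs0, hs1, hs2⟩ := kernelSum_bounds h0 h1 L
  have hs3 := kernelSum_le h0 L hL (by linarith)
  set y : ℝ := L * θ with hy
  have hy0 : 0 ≤ y := h0.trans hθ
  set A := limitCos arccosKernelOne arccosKernelZero L (cos θ) with hA
  have hLp : (0 : ℝ) < L + 1 := by positivity
  have hAlow : cos θ * (1 - y / (2 * π)) ≤ A := by
    rw [hA, limitCos_eq, le_div_iff₀ hLp]
    linarith
  have hAup : A ≤ 1 - y / (2 * π) + y ^ 2 := by
    rw [hA, limitCos_eq, div_le_iff₀ hLp]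
    have : (L : ℝ) ^ 3 * θ ^ 2 ≤ y ^ 2 * (L + 1) := by
      rw [hy]
      nlinarith [mul_nonneg (sq_nonneg θ) (sq_nonneg (L : ℝ))]
    linarith
  have hyπ : L / (2 * π) * θ = y / (2 * π) := by rw [hy]; ring
  have hyπ0 : 0 ≤ y / (2 * π) := by positivity
  have hyπ1 : y / (2 * π) ≤ 1 := by
    rw [div_le_one (by positivity)]
    linarith
  rw [remainder, hyπ, abs_le]
  constructor
  · have : 1 - y / (2 * π) ≤ A / cos θ := by
      rw [le_div_iff₀ hc]
      linarith
    nlinarith [sq_nonneg y]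
  -- Dividing by `cos θ ≥ 1 - y ^ 2 / 2` with `y ≤ 1` turns the error `y ^ 2` into `3 * y ^ 2`,
  -- since `3 - 1 / 2 - 3 / 2 = 1`.
  · have : A / cos θ ≤ 1 - y / (2 * π) + 3 * y ^ 2 := by
      rw [div_le_iff₀ hc]
      refine hAup.trans ?_
      have h5 : θ ^ 2 ≤ y ^ 2 := pow_le_pow_left₀ h0 hθ 2
      have h6 : y ^ 2 ≤ 1 := by nlinarith
      have h7 : (1 - y / (2 * π) + 3 * y ^ 2) * (1 - y ^ 2 / 2) ≤
          (1 - y / (2 * π) + 3 * y ^ 2) * cos θ := by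
        refine mul_le_mul_of_nonneg_left (by linarith) ?_
        nlinarith [sq_nonneg y]
      refine le_trans ?_ h7
      nlinarith [sq_nonneg y, mul_nonneg hyπ0 (sq_nonneg y)]
    linarith

/-- The linear loss is at least `L * θ / 8` and beats the remainder `3 * (L * θ) ^ 2` once `L * θ <
1 / 24`. -/
lemma lt_reluAngle {L : ℕ} {θ : ℝ} (hL1 : 1 ≤ L) (h0 : 0 < θ) (hL : L * θ < 1 / 100) :
    θ < reluAngle L θ := by
  have hπ := pi_pos
  have hπ4 := pi_le_four
  have hπ3 := pi_gt_three
  have hL1' : (1 : ℝ) ≤ L := by exact_mod_cast hL1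
  have hθ : θ ≤ L * θ := by nlinarith
  have hc : 0 < cos θ := cos_pos_of_mem_Ioo ⟨by linarith, by linarith⟩
  have hr := (abs_le.1 (abs_remainder_le hL1 h0.le (by linarith))).2
  have hlt : limitCos arccosKernelOne arccosKernelZero L (cos θ) < cos θ := by
    rw [limitCos_eq_remainder hc.ne']
    refine mul_lt_of_lt_one_left hc ?_
    have h2 : (L * θ) / 8 ≤ L / (2 * π) * θ := by
      rw [div_mul_eq_mul_div]
      gcongr
      linarith
    nlinarith
  have h3 := arccos_lt_arccos (by linarith [(limitCos_mem (L := L) h0.le (by linarith)).1]) hlt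
    (cos_le_one θ)
  rwa [arccos_cos h0.le (by linarith)] at h3

/-- To first order the product is `1 + u / 2`; the hypotheses say that `y / u` is comparable to `π`,
so that all other terms are small against `u`. -/
lemma one_lt_mul_of_small {u y : ℝ} (hu0 : 0 < u) (hyu : y ≤ 4 * u) (huy : u ≤ y / 3)
    (hy : y < 1 / 100) : 1 < (1 - y ^ 2 / 2) * (1 - u / 2) * (1 + u * (1 - y)) := by
  have hy0 : 0 < y := by linarith
  have e1 : y ^ 2 ≤ u / 25 := by nlinarith
  have e2 : u * (9 / 10) ≤ u * (1 - y) := mul_le_mul_of_nonneg_left (by linarith) hu0.le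
  have e3 : (1 - u / 50) * (1 - u / 2) ≤ (1 - y ^ 2 / 2) * (1 - u / 2) :=
    mul_le_mul_of_nonneg_right (by linarith) (by linarith)
  have e4 : (1 - u / 50) * (1 - u / 2) * (1 + u * (9 / 10)) ≤
      (1 - y ^ 2 / 2) * (1 - u / 2) * (1 + u * (1 - y)) := by
    refine mul_le_mul e3 (by linarith) (by positivity) ?_
    exact mul_nonneg (by linarith) (by linarith)
  refine lt_of_lt_of_le ?_ e4
  have e5 : u ^ 2 ≤ u / 300 := by nlinarith
  have e6 : (1 - u / 50) * (1 - u / 2) * (1 + u * (9 / 10)) =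
      1 + 19 / 50 * u - 229 / 500 * u ^ 2 + 9 / 1000 * u ^ 3 := by ring
  rw [e6]
  linarith [pow_pos hu0 3]

/-- After clearing denominators and using `ρ ≤ 1`, it suffices that `L + 1 < kernelSum L θ * (1 + (L
+ 1) * t / π)`. With `u = (L + 1) * θ / π`, the sum divided by `L + 1` has lost at most about `u /
2`, while the second factor gains about `u`. -/
lemma limitCos_succ_lt {L : ℕ} {θ : ℝ} (h0 : 0 < θ) (hL : (L + 1) * θ < 1 / 100) :
    limitCos arccosKernelOne arccosKernelZero (L + 1) (cos θ) <
      limitCos arccosKernelOne arccosKernelZero L (cos θ) := by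
  have hπ := pi_pos
  have hπ4 := pi_le_four
  have hπ3 := pi_gt_three
  have hLn : (0 : ℝ) ≤ L := Nat.cast_nonneg L
  set y : ℝ := (L + 1) * θ with hy
  have hLy : L * θ ≤ y := by rw [hy]; nlinarith
  have hθy : θ ≤ y := by rw [hy]; nlinarith
  have hy0 : 0 < y := h0.trans_le hθy
  have h1 : θ ≤ π / 2 := by linarith
  obtain ⟨t, ρ, ht0, ht1, ht2, hρ, hρ1, heq⟩ := exists_kernelSum_succ h0.le h1 L
  obtain ⟨hs0, -, hs2⟩ := kernelSum_bounds h0.le h1 L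
  rw [limitCos_eq, limitCos_eq, div_lt_div_iff₀ (by positivity) (by positivity), heq]
  push_cast
  set u : ℝ := y / π with hu
  have hu0 : 0 < u := by positivity
  have hyu : y ≤ 4 * u := by
    rw [hu, mul_div_assoc', le_div_iff₀ hπ]
    nlinarith
  have huy : u ≤ y / 3 := by rw [hu]; gcongr
  have hcos : 1 - y ^ 2 / 2 ≤ cos θ := by
    have := one_sub_sq_div_two_le_cos (x := θ)
    nlinarith [pow_le_pow_left₀ h0.le hθy 2]
  have hS : (L + 1) * ((1 - y ^ 2 / 2) * (1 - u / 2)) ≤ kernelSum L θ := by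
    refine le_trans ?_ hs2
    have h3 : L * θ / (2 * π) ≤ u / 2 := by
      rw [hu, div_div, mul_comm π 2]
      gcongr
    have h4 : (1 - y ^ 2 / 2) * (1 - u / 2) ≤ cos θ * (1 - L * θ / (2 * π)) := by
      refine mul_le_mul hcos (by linarith) (by linarith) (by nlinarith)
    calc _ ≤ (L + 1) * (cos θ * (1 - L * θ / (2 * π))) := by gcongr
      _ = _ := by ring
  have hT : u * (1 - y) ≤ (L + 1) * (t / π) := by
    have h5 : θ * (1 - y) ≤ t := by nlinarith
    have h6 : u * (1 - y) = (L + 1) * (θ * (1 - y) / π) := by rw [hu, hy]; ring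
    rw [h6]
    gcongr
  have hpoly := one_lt_mul_of_small hu0 hyu huy hL
  have hmain : (L + 1 : ℝ) < kernelSum L θ * (1 + (L + 1) * (t / π)) := by
    calc (L + 1 : ℝ) = (L + 1) * 1 := by ring
      _ < (L + 1) * ((1 - y ^ 2 / 2) * (1 - u / 2) * (1 + u * (1 - y))) := by gcongr
      _ = (L + 1) * ((1 - y ^ 2 / 2) * (1 - u / 2)) * (1 + u * (1 - y)) := by ring
      _ ≤ _ := by
          refine mul_le_mul hS (by linarith) ?_ hs0
          have : 0 ≤ u * (1 - y) := mul_nonneg hu0.le (by linarith)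
          linarith
  have h7 : ρ * (L + 1) ≤ L + 1 := mul_le_of_le_one_left (by linarith) hρ1
  have h8 : (ρ + kernelSum L θ * (1 - t / π)) * (L + 1) =
      ρ * (L + 1) + kernelSum L θ * (L + 2) - kernelSum L θ * (1 + (L + 1) * (t / π)) := by ring
  rw [h8]
  linarith

lemma reluAngle_lt_reluAngle {L₁ L₂ : ℕ} {θ : ℝ} (h : L₁ < L₂) (h0 : 0 < θ)
    (hL : L₂ * θ < 1 / 100) : reluAngle L₁ θ < reluAngle L₂ θ := by
  have hπ3 := pi_gt_three
  have hL2 : (1 : ℝ) ≤ L₂ := by exact_mod_cast (by omega : 1 ≤ L₂)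
  have h1 : θ ≤ π / 2 := by nlinarith
  have hlt : limitCos arccosKernelOne arccosKernelZero L₂ (cos θ) <
      limitCos arccosKernelOne arccosKernelZero L₁ (cos θ) := by
    clear hL2
    induction L₂, h using Nat.le_induction with
    | base =>
      push_cast at hL
      exact limitCos_succ_lt h0 hL
    | succ n hn ih =>
      push_cast at hL
      exact (limitCos_succ_lt h0 hL).trans (ih (by nlinarith))
  exact arccos_lt_arccos (by linarith [(limitCos_mem (L := L₂) h0.le h1).1]) hlt
    (limitCos_mem h0.le h1).2

lemma remainder_isLittleO {L : ℕ} (hL : 1 ≤ L) :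
    (remainder L) =o[𝓝[≥] (0 : ℝ)] (fun θ : ℝ => θ) := by
  have hL0 : (0 : ℝ) < L := by exact_mod_cast hL
  rw [isLittleO_iff]
  intro ε hε
  have h1 : ∀ᶠ θ : ℝ in 𝓝[≥] (0 : ℝ), θ < min (1 / (L : ℝ)) (ε / (3 * (L : ℝ) ^ 2)) :=
    nhdsWithin_le_nhds (gt_mem_nhds (by positivity))
  filter_upwards [h1, self_mem_nhdsWithin] with θ hθ hθ0
  have hθ0' : 0 ≤ θ := hθ0
  have h2 := (lt_min_iff.1 hθ).1
  have h3 := (lt_min_iff.1 hθ).2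
  rw [lt_div_iff₀ hL0] at h2
  rw [lt_div_iff₀ (by positivity)] at h3
  rw [Real.norm_eq_abs, Real.norm_eq_abs, abs_of_nonneg hθ0']
  refine (abs_remainder_le hL hθ0' (by linarith)).trans ?_
  nlinarith

lemma abs_remainder_le_mul {ε : ℝ} (hε : 0 < ε) : ∃ δ : ℝ, 0 < δ ∧ ∀ (L : ℕ) (θ : ℝ), 1 ≤ L →
    0 ≤ θ → (L : ℝ) * θ < δ → |remainder L θ| ≤ ε * ((L : ℝ) * θ) := by
  refine ⟨min 1 (ε / 3), by positivity, fun L θ hL h0 h => ?_⟩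
  obtain ⟨h2, h3⟩ := lt_min_iff.1 h
  have h4 : 0 ≤ L * θ := by positivity
  refine (abs_remainder_le hL h0 h2.le).trans ?_
  nlinarith

end DepthExpansion

end WideNet

end


theorem mainTheorem1 :
    ∃ (φ : (L d : ℕ) → EuclideanSpace ℝ (Fin d) → EuclideanSpace ℝ (Fin d) → ℝ)
      (r : ℕ → ℝ → ℝ),
      -- `φ L d x z` is the model gradient angle of the infinitely wide ReLU network
      (∀ (L d : ℕ) (x z : EuclideanSpace ℝ (Fin d)), 1 ≤ L → x ≠ 0 → z ≠ 0 →
        φ L d x z ∈ Icc 0 π ∧ WideNet.IsReLUAngle L x z (φ L d x z)) ∧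
      -- the expansion, with remainder `r L θ`
      (∀ (L d : ℕ) (x z : EuclideanSpace ℝ (Fin d)), 1 ≤ L → x ≠ 0 → z ≠ 0 →
        angle x z < π / 2 →
        cos (φ L d x z) =
          (1 - (L : ℝ) / (2 * π) * angle x z + r L (angle x z)) * cos (angle x z)) ∧
      -- for each depth, the remainder is `o(θ)`
      (∀ L : ℕ, 1 ≤ L → (r L) =o[𝓝[≥] (0 : ℝ)] (fun θ : ℝ => θ)) ∧
      -- uniformly in the depth, in the regime `θ = o(1 / L)`, the remainder is `o(L θ)`
      (∀ ε : ℝ, 0 < ε → ∃ δ : ℝ, 0 < δ ∧ ∀ (L : ℕ) (θ : ℝ), 1 ≤ L → 0 ≤ θ → (L : ℝ) * θ < δ →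
        |r L θ| ≤ ε * ((L : ℝ) * θ)) ∧
      -- the linear network keeps the input angle
      (∀ (L d : ℕ) (x z : EuclideanSpace ℝ (Fin d)), 1 ≤ L → x ≠ 0 → z ≠ 0 →
        WideNet.IsLinearAngle L x z (angle x z)) ∧
      -- in the regime `θ = o(1 / L)`, `φ` exceeds the input angle and grows with the depth
      (∃ c : ℝ, 0 < c ∧
        (∀ (L d : ℕ) (x z : EuclideanSpace ℝ (Fin d)), 1 ≤ L → x ≠ 0 → z ≠ 0 →
          0 < angle x z → (L : ℝ) * angle x z < c → angle x z < φ L d x z) ∧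
        (∀ (L₁ L₂ d : ℕ) (x z : EuclideanSpace ℝ (Fin d)), 1 ≤ L₁ → L₁ < L₂ → x ≠ 0 → z ≠ 0 →
          0 < angle x z → (L₂ : ℝ) * angle x z < c → φ L₁ d x z < φ L₂ d x z)) := by
  -- The remainder is defined by solving the expansion for it, so the formula is an identity
  -- wherever `cos θ ≠ 0`, and only its size needs an estimate.
  refine ⟨fun L d x z => WideNet.reluAngle L (angle x z), WideNet.remainder, ?_, ?_, ?_, ?_, ?_,
    1 / 100, by norm_num, ?_, ?_⟩
  · intro L d x z _ hx hz
    exact ⟨⟨arccos_nonneg _, arccos_le_pi _⟩, WideNet.isReLUAngle_reluAngle hx hz⟩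
  · intro L d x z _ _ _ h
    have h0 := angle_nonneg x z
    rw [WideNet.cos_reluAngle h0 h.le]
    exact WideNet.limitCos_eq_remainder
      (cos_pos_of_mem_Ioo ⟨by linarith [pi_pos], h⟩).ne'
  · exact fun L hL => WideNet.remainder_isLittleO hL
  · exact fun ε hε => WideNet.abs_remainder_le_mul hε
  · exact fun L d x z _ hx hz => WideNet.isLinearAngle_angle hx hz
  · exact fun L d x z hL _ _ h0 h => WideNet.lt_reluAngle hL h0 h
  · exact fun L₁ L₂ d x z _ h _ _ h0 hL => WideNet.reluAngle_lt_reluAngle h h0 hL
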